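/- Let $\Lambda$ be a lattice (a free abelian group of finite rank), let $V=\Lambda\otimes\mathbb{R}$ and $V^*=\mathrm{Hom}(\Lambda,\mathbb{R})$. Let $\mathcal{D}$ be a triangulated category over $\Lambda$, i.e. equipped with a homomorphism $\lambda\colon K(\mathcal{D})\to\Lambda$ from its Grothendieck group, and let $\mathcal{H}$ be a bounded heart in $\mathcal{D}$, i.e. the heart of a bounded t-structure. *Definitions.* Bounded hearts are ordered by inclusion of the co-aisles of the corresponding t-structures, so that $\mathcal{H}[1]\ge\mathcal{H}$. For a bounded heart $\mathcal{K}$, the effective cone $E(\mathcal{K})\subseteq\Lambda$ is the submonoid generated by the elements $\lambda([k])$, $k\in\mathcal{K}$, and the heart cone is $C(\mathcal{K})=\{v\in V^*\mid v(\lambda([k]))\ge 0 \text{ for all } k\in\mathcal{K}\}$. A real cone is a non-empty subset of a real vector space closed under sums and non-negative scalars; a face of a cone $\sigma$ is a subcone $\tau\subseteq\sigma$ such that for $a,b\in\sigma$ one has $a+b\in\tau$ iff $a,b\in\tau$. A fan is a set of cones that is closed under taking faces and in which any two cones intersect in a common face; it is complete if the union of its cones is the whole space. A cofan is a set of cones such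 that $\sigma-\tau$ is in it for each of its cones $\sigma$ and each face $\tau$ of $\sigma$, and such that for any two of its cones $\sigma,\sigma'$ there is a face $\tau$ of $\sigma$ with $\sigma+\sigma'=\sigma-\tau$. The fan associated to a cofan in $V$ consists of all faces of the dual cones $\sigma^\vee=\{v\in V^*\mid v|_\sigma\ge 0\}$ of its cones $\sigma$. The real heart cofan $\Sigma_{\mathbb{R}}(\mathcal{H})$ is the set of convex hulls in $V$ of all cones $E(\mathcal{K})-\kappa$, where $\mathcal{K}$ is a bounded heart with $\mathcal{H}[1]\ge\mathcal{K}\ge\mathcal{H}$ and $\kappa\subseteq E(\mathcal{K})$ is a submonoid. Let $\Delta(\mathcal{H})$ be the set of all heart cones $C(\mathcal{K})$ of bounded hearts $\mathcal{K}$ with $\mathcal{H}[1]\ge\mathcal{K}\ge\mathcal{H}$, together with all faces of these cones. Then: 1. The heart cone $C(\mathcal{H})$ is closed in $V^*$, and if $\lambda$ is surjective (for example, if $\Lambda=K(\mathcal{D})$), it is strictly convex, i.e. $C(\mathcal{H})\cap -C(\mathcal{H})=\{0\}$. 2. $\Delta(\mathcal{H})$ is a fan in $V^*$; the set $\Sigma_{\mathbb{R}}(\mathcal{H})$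 is a cofan in $V$, and $\Delta(\mathcal{H})$ is the fan associated to it. 3. $\Delta(\mathcal{H})$ does not depend on the ambient triangulated category: if $\mathcal{H}'$ is a bounded heart in a triangulated category $\mathcal{D}'$ with a homomorphism $\lambda'\colon K(\mathcal{D}')\to\Lambda$, and $e\colon\mathcal{H}\to\mathcal{H}'$ is an equivalence of categories with $\lambda'([e(h)])=\lambda([h])$ for all $h\in\mathcal{H}$, then $\Delta(\mathcal{H}')=\Delta(\mathcal{H})$. 4. If $\mathcal{H}$ is a length category (every object is noetherian and artinian), then $\Delta(\mathcal{H})$ is complete, i.e. the union of its cones is $V^*$. -/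

import Mathlib

open CategoryTheory CategoryTheory.Limits CategoryTheory.Pretriangulated
open CategoryTheory.Triangulated
open scoped TensorProduct Topology

universe v v' u u' w

namespace HeartFan

/-! ### Convex geometry

An integral cone in a lattice `Λ` is a submonoid, i.e. an `AddSubmonoid Λ`. A real cone in a real
vector space `M` is a `PointedCone ℝ M`, and `PointedCone.IsFaceOf` is the face relation. Sums
`σ + σ'` of cones (integral or real) are Minkowski sums, which is what the supremum `σ ⊔ σ'` of
submonoids, respectively of pointed cones, is. -/

section Integral

variable {Λ : Type*} [AddCommGroup Λ]

/-- The Minkowski difference `σ - κ = {a - b | a ∈ σ, b ∈ κ}` of integral cones. -/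
def intDiff (σ κ : AddSubmonoid Λ) : AddSubmonoid Λ where
  carrier := {x | ∃ a ∈ σ, ∃ b ∈ κ, x = a - b}
  zero_mem' := ⟨0, σ.zero_mem, 0, κ.zero_mem, by simp⟩
  add_mem' := by
    rintro _ _ ⟨a, ha, b, hb, rfl⟩ ⟨a', ha', b', hb', rfl⟩
    exact ⟨a + a', σ.add_mem ha ha', b + b', κ.add_mem hb hb', by abel⟩

/-- The cofaces of an integral cone `σ`: its localisations `σ - κ` at subcones `κ ⊆ σ`. -/
def cofaces (σ : AddSubmonoid Λ) : Set (AddSubmonoid Λ) :=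
  {ρ | ∃ κ : AddSubmonoid Λ, κ ≤ σ ∧ ρ = intDiff σ κ}

end Integral

section Real

variable {M : Type*} [AddCommGroup M] [Module ℝ M]

/-- The Minkowski difference `σ - κ = {a - b | a ∈ σ, b ∈ κ}` of real cones. -/
def realDiff (σ κ : PointedCone ℝ M) : PointedCone ℝ M where
  carrier := {x | ∃ a ∈ σ, ∃ b ∈ κ, x = a - b}
  zero_mem' := ⟨0, σ.zero_mem, 0, κ.zero_mem, by simp⟩
  add_mem' := by
    rintro _ _ ⟨a, ha, b, hb, rfl⟩ ⟨a', ha', b', hb', rfl⟩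
    exact ⟨a + a', σ.add_mem ha ha', b + b', κ.add_mem hb hb', by abel⟩
  smul_mem' := by
    rintro c _ ⟨a, ha, b, hb, rfl⟩
    exact ⟨c • a, Submodule.smul_mem σ c ha, c • b, Submodule.smul_mem κ c hb, smul_sub c a b⟩

/-- A fan: a set of real cones which is closed under faces, and in which any two cones intersect
in a common face. -/
structure IsFan (S : Set (PointedCone ℝ M)) : Prop where
  face_mem : ∀ σ ∈ S, ∀ τ : PointedCone ℝ M, τ.IsFaceOf σ → τ ∈ S
  inter_isFaceOf : ∀ σ ∈ S, ∀ τ ∈ S, (σ ⊓ τ).IsFaceOf σ ∧ (σ ⊓ τ).IsFaceOf τ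

/-- A fan is complete if its support, the union of its cones, is the whole space. -/
def IsComplete (S : Set (PointedCone ℝ M)) : Prop :=
  (⋃ σ ∈ S, (σ : Set M)) = Set.univ

/-- A real cofan: a set of real cones which is closed under localisation at faces, and in which
the sum of any two cones is a localisation of the first (hence also of the second) at a face. -/
structure IsCofan (S : Set (PointedCone ℝ M)) : Prop where
  diff_mem : ∀ σ ∈ S, ∀ τ : PointedCone ℝ M, τ.IsFaceOf σ → realDiff σ τ ∈ S
  sum_eq_diff : ∀ σ ∈ S, ∀ σ' ∈ S, ∃ τ : PointedCone ℝ M, τ.IsFaceOf σ ∧ σ ⊔ σ' = realDiff σ τ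

end Real

section Lattice

variable (Λ : Type*) [AddCommGroup Λ]

/-- The pairing `(r ⊗ a, f) ↦ r * f a` between `Λ_ℝ = ℝ ⊗ Λ` and `Λ_ℝ^* = Hom(Λ, ℝ)`. -/
noncomputable def pairing : (ℝ ⊗[ℤ] Λ) →ₗ[ℝ] (Λ →+ ℝ) →ₗ[ℝ] ℝ :=
  LinearMap.liftBaseChange ℝ
    ({ toFun := fun a =>
        { toFun := fun f => f a
          map_add' := fun _ _ => rfl
          map_smul' := fun _ _ => rfl }
       map_zero' := by ext f; simp
       map_add' := fun a b => by ext f; simp } : Λ →+ (Λ →+ ℝ) →ₗ[ℝ] ℝ).toIntLinearMap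

@[simp]
lemma pairing_tmul (r : ℝ) (a : Λ) (f : Λ →+ ℝ) : pairing Λ (r ⊗ₜ[ℤ] a) f = r * f a := by
  simp [pairing]

/-- The topology of pointwise convergence on `Hom(Λ, ℝ)`. For a lattice `Λ` this is the standard
topology of a finite-dimensional real vector space. -/
abbrev dualTopology : TopologicalSpace (Λ →+ ℝ) :=
  TopologicalSpace.induced (fun f : Λ →+ ℝ => (f : Λ → ℝ)) inferInstance

variable {Λ}

/-- The real cone `σ_ℝ` in `ℝ ⊗ Λ` generated by an integral cone `σ`; it is the convex hull of
`σ`, see `coe_realify`. -/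
def realify (σ : AddSubmonoid Λ) : PointedCone ℝ (ℝ ⊗[ℤ] Λ) :=
  PointedCone.hull ℝ ((fun a : Λ => (1 : ℝ) ⊗ₜ[ℤ] a) '' (σ : Set Λ))

open scoped Pointwise in
lemma coe_realify (σ : AddSubmonoid Λ) :
    (realify σ : Set (ℝ ⊗[ℤ] Λ)) =
      convexHull ℝ ((fun a : Λ => (1 : ℝ) ⊗ₜ[ℤ] a) '' (σ : Set Λ)) := by
  set S : Set (ℝ ⊗[ℤ] Λ) := (fun a : Λ => (1 : ℝ) ⊗ₜ[ℤ] a) '' (σ : Set Λ) with hS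
  have h0 : (0 : ℝ ⊗[ℤ] Λ) ∈ convexHull ℝ S :=
    subset_convexHull ℝ S ⟨0, σ.zero_mem, TensorProduct.tmul_zero _ _⟩
  have hSS : S + S ⊆ S := by
    rintro _ ⟨_, ⟨a, ha, rfl⟩, _, ⟨b, hb, rfl⟩, rfl⟩
    exact ⟨a + b, σ.add_mem ha hb, TensorProduct.tmul_add _ _ _⟩
  have hadd : ∀ x ∈ convexHull ℝ S, ∀ y ∈ convexHull ℝ S, x + y ∈ convexHull ℝ S := by
    intro x hx y hy
    have hxy : x + y ∈ convexHull ℝ S + convexHull ℝ S := Set.add_mem_add hx hy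
    rw [← convexHull_add] at hxy
    exact convexHull_mono hSS hxy
  have hnat : ∀ (n : ℕ), ∀ x ∈ convexHull ℝ S, (n : ℝ) • x ∈ convexHull ℝ S := by
    intro n x hx
    induction n with
    | zero => simpa using h0
    | succ n ih =>
      push_cast
      rw [add_smul, one_smul]
      exact hadd _ ih _ hx
  have hsmul : ∀ c : ℝ, 0 ≤ c → ∀ x ∈ convexHull ℝ S, c • x ∈ convexHull ℝ S := by
    intro c hc x hx
    obtain ⟨n, hn⟩ := exists_nat_gt c
    have hn0 : (0 : ℝ) < n := lt_of_le_of_lt hc hn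
    have hmem := (convex_convexHull ℝ S).smul_mem_of_zero_mem h0 (hnat n x hx)
      (t := c / n) ⟨by positivity, by rw [div_le_one hn0]; exact hn.le⟩
    rwa [smul_smul, div_mul_cancel₀ _ hn0.ne'] at hmem
  let P : PointedCone ℝ (ℝ ⊗[ℤ] Λ) :=
    { carrier := convexHull ℝ S
      zero_mem' := h0
      add_mem' := fun {x y} hx hy => hadd x hx y hy
      smul_mem' := fun c x hx => hsmul c.1 c.2 x hx }
  apply Set.Subset.antisymm
  · have : realify σ ≤ P := Submodule.span_le.2 (subset_convexHull ℝ S)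
    exact this
  · exact convexHull_min Submodule.subset_span (realify σ).toConvexCone.convex

/-- The fan associated to a set of real cones in `ℝ ⊗ Λ` (in practice, a cofan): all faces of
the dual cones. -/
noncomputable def associatedFan (S : Set (PointedCone ℝ (ℝ ⊗[ℤ] Λ))) :
    Set (PointedCone ℝ (Λ →+ ℝ)) :=
  {τ | ∃ σ ∈ S, τ.IsFaceOf (PointedCone.dual (pairing Λ) (σ : Set (ℝ ⊗[ℤ] Λ)))}

end Lattice

/-! ### Triangulated categories -/

/-- A category is a length category if every object is noetherian and artinian. -/
def IsLength (A : Type*) [Category* A] : Prop :=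
  ∀ X : A, IsNoetherianObject X ∧ IsArtinianObject X

variable {D : Type u} [Category.{v} D] [Preadditive D] [HasZeroObject D] [HasShift D ℤ]
  [∀ n : ℤ, (shiftFunctor D n).Additive] [Pretriangulated D]

variable (D) in
/-- The Grothendieck group of a triangulated category: generated by the objects, with a relation
`[Y] = [X] + [Z]` for each distinguished triangle `X ⟶ Y ⟶ Z ⟶ X⟦1⟧`. -/
abbrev K₀ : Type u :=
  FreeAbelianGroup D ⧸ AddSubgroup.closure
    {x : FreeAbelianGroup D | ∃ T ∈ distTriang D,
      x = FreeAbelianGroup.of T.obj₂ - (FreeAbelianGroup.of T.obj₁ + FreeAbelianGroup.of T.obj₃)}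

/-- The class of an object in the Grothendieck group. -/
def K₀.mk (X : D) : K₀ D := QuotientAddGroup.mk (FreeAbelianGroup.of X)

/-- A t-structure is bounded if each object is in some `t.le n` and in some `t.ge n`. -/
def IsBounded (t : TStructure D) : Prop := t.bounded = ⊤

/-- The shifted t-structure, whose heart is `H[1]` if `t` has heart `H`. -/
def shiftOne (t : TStructure D) : TStructure D where
  le n := t.le (n - 1)
  ge n := t.ge (n - 1)
  le_shift n a n' h X hX := t.le_shift (n - 1) a (n' - 1) (by lia) X hX
  ge_shift n a n' h X hX := t.ge_shift (n - 1) a (n' - 1) (by lia) X hX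
  zero' X Y f hX hY :=
    t.zero_of_isLE_of_isGE f (0 - 1) (1 - 1) (by lia) ⟨hX⟩ ⟨hY⟩
  le_zero_le := t.le_monotone (by lia)
  ge_one_le := t.ge_antitone (by lia)
  exists_triangle_zero_one A := t.exists_triangle A (0 - 1) (1 - 1) (by lia)

lemma heart_shiftOne_iff (t : TStructure D) (X : D) :
    (shiftOne t).heart X ↔ t.heart (X⟦(-1 : ℤ)⟧) := by
  have h1 := t.isLE_shift_iff X (-1) (-1) 0 (by lia)
  have h2 := t.isGE_shift_iff X (-1) (-1) 0 (by lia)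
  rw [t.mem_heart_iff, h1, h2, ← t.le_iff_isLE, ← t.ge_iff_isGE]
  rfl

/-- The partial order on (hearts of) t-structures given by inclusion of co-aisles; the co-aisle
of `t` is `t.ge 1`. `HeartLE t k` says that `k` is greater than or equal to `t`, and the
convention is such that `HeartLE t (shiftOne t)`. -/
def HeartLE (t k : TStructure D) : Prop := t.ge 1 ≤ k.ge 1

lemma heartLE_shiftOne (t : TStructure D) : HeartLE t (shiftOne t) :=
  t.ge_antitone (by lia : (1 : ℤ) - 1 ≤ 1)

variable {Λ : Type w} [AddCommGroup Λ]

/-- The effective cone in `Λ` of a class `P` of objects, for example of a heart: the integral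
cone generated by the elements `l [X]` with `X` in `P`. -/
def effectiveCone (l : K₀ D →+ Λ) (P : ObjectProperty D) : AddSubmonoid Λ :=
  AddSubmonoid.closure {a | ∃ X : D, P X ∧ a = l (K₀.mk X)}

/-- The heart cone in `Hom(Λ, ℝ)` of a class `P` of objects, for example of a heart: all `f` with
`f (l [X]) ≥ 0` for all `X` in `P`. -/
def heartCone (l : K₀ D →+ Λ) (P : ObjectProperty D) : PointedCone ℝ (Λ →+ ℝ) where
  carrier := {f | ∀ X : D, P X → 0 ≤ f (l (K₀.mk X))}
  zero_mem' := fun _ _ => le_refl _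
  add_mem' := fun hf hg X hX => add_nonneg (hf X hX) (hg X hX)
  smul_mem' := fun c _ hf X hX => mul_nonneg c.2 (hf X hX)

/-- `k` is the t-structure of a bounded heart `K` with `H[1] ≥ K ≥ H`, where `H` is the heart
of `t`. -/
structure IsTwoTerm (t k : TStructure D) : Prop where
  bounded : IsBounded k
  ge : HeartLE t k
  le : HeartLE k (shiftOne t)

/-- The heart fan of the heart `H` of `t`: the heart cones of all bounded hearts `K` with
`H[1] ≥ K ≥ H`, together with all their faces. -/
def heartFan (l : K₀ D →+ Λ) (t : TStructure D) : Set (PointedCone ℝ (Λ →+ ℝ)) :=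
  {τ | ∃ k : TStructure D, IsTwoTerm t k ∧ τ.IsFaceOf (heartCone l k.heart)}

/-- The integral heart cofan of the heart `H` of `t`: the cofaces of the effective cones of all
bounded hearts `K` with `H[1] ≥ K ≥ H`. -/
def intHeartCofan (l : K₀ D →+ Λ) (t : TStructure D) : Set (AddSubmonoid Λ) :=
  {σ | ∃ k : TStructure D, IsTwoTerm t k ∧ σ ∈ cofaces (effectiveCone l k.heart)}

/-- The real heart cofan: the convex hulls of the cones of the integral heart cofan. -/
def realHeartCofan (l : K₀ D →+ Λ) (t : TStructure D) : Set (PointedCone ℝ (ℝ ⊗[ℤ] Λ)) :=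
  realify '' intHeartCofan l t

end HeartFan

/-!
The proof reduces everything about the hearts `K` with `H[1] ≥ K ≥ H` to torsion pairs in the
abelian category `H`, and then to a single property of integral cones.

A t-structure `k` between `t` and its shift cuts out the torsion pair `(T, F)` in `H` with
`T = H ∩ k.le 0` and `F = H ∩ k.ge 1`, and conversely each torsion pair is obtained in this way by
tilting: the aisle of `tilt` consists of the extensions of torsion objects by objects in negative
degrees. Its truncation triangles come from the associativity of extensions in a triangulated
category, because each object is successively filtered by its negative part, the torsion and
torsion-free parts of its zeroth cohomology, and its positive part. The heart of `k` consists of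
the extensions of objects of `T` by objects of `F[1]`, so that its effective cone is generated by
the classes of `T` and the negatives of the classes of `F`
(`effectiveCones_eq_torsionCones`). This set of cones only involves the abelian category `H` and
the classes of its objects, whence the independence of the ambient triangulated category.

If `(T, F)` and `(T', F')` are torsion pairs with cones `E` and `E'`, decomposing an object of
`T'` with respect to `(T, F)` gives a sub-object in `T` and a quotient in `T' ∩ F`, and dually for
`F'`. Hence `E' ⊆ E + (E' ∩ -E)` (`hasSplitting_torsionCones`). This property alone implies that
the dual cones and their faces form a fan: if `f` and `g` are non-negative on `E` and `f + g` is
non-negative on `E'`, then `f` and `g` vanish on `E' ∩ -E` and so are non-negative on `E'`. It also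
shows that the sum of two real cofaces is the localisation of the first at the face of those
elements which become invertible in the sum, which gives the cofan
(`HasSplitting.isFan`, `HasSplitting.isCofan`).

For completeness, let `H` be a length category and `f` a functional. The objects all of whose
quotients have non-negative value under `f` form a torsion class, since a noetherian object has a
largest such subobject; and an object without non-zero morphisms from this class has non-positive
value, since otherwise a minimal subobject of positive value would lie in the class
(`exists_torsionPair_of_isLength`). Thus `f` lies in the dual cone of this torsion pair.
-/

namespace HeartFan

/-! ### Fans and cofans of families of integral cones -/

section Convex

section Real

variable {M : Type*} [AddCommGroup M] [Module ℝ M]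

/-- Faces can be recognised using sums only, without positive scalars. -/
lemma isFaceOf_of_add_mem {τ σ : PointedCone ℝ M} (hle : τ ≤ σ)
    (h : ∀ x ∈ σ, ∀ y ∈ σ, x + y ∈ τ → x ∈ τ) : τ.IsFaceOf σ where
  le := hle
  mem_of_smul_add_mem {x y a} hx hy ha hxy := by
    have hax : a • x ∈ τ := h _ (PointedCone.smul_mem σ ha.le hx) _ hy hxy
    have := PointedCone.smul_mem τ (inv_nonneg.2 ha.le) hax
    rwa [smul_smul, inv_mul_cancel₀ ha.ne', one_smul] at this

/-- The elements of `σ` which become invertible in a larger cone `ρ` form a face of `σ`. -/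
def invertibleFace (σ ρ : PointedCone ℝ M) : PointedCone ℝ M where
  carrier := {x | x ∈ σ ∧ -x ∈ ρ}
  zero_mem' := ⟨σ.zero_mem, by simp⟩
  add_mem' := fun {x y} hx hy =>
    ⟨σ.add_mem hx.1 hy.1, by rw [neg_add]; exact ρ.add_mem hx.2 hy.2⟩
  smul_mem' := fun c x hx =>
    ⟨Submodule.smul_mem σ c hx.1, by rw [← smul_neg]; exact Submodule.smul_mem ρ c hx.2⟩

lemma invertibleFace_isFaceOf {σ ρ : PointedCone ℝ M} (h : σ ≤ ρ) :
    (invertibleFace σ ρ).IsFaceOf σ := by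
  refine isFaceOf_of_add_mem (fun x hx => hx.1) fun x hx y hy hxy => ⟨hx, ?_⟩
  have := ρ.add_mem hxy.2 (h hy)
  rwa [neg_add, neg_add_cancel_right] at this

end Real

variable {Λ : Type*} [AddCommGroup Λ]

lemma le_intDiff (σ κ : AddSubmonoid Λ) : σ ≤ intDiff σ κ :=
  fun a ha => ⟨a, ha, 0, κ.zero_mem, by simp⟩

lemma neg_mem_intDiff (σ : AddSubmonoid Λ) {κ : AddSubmonoid Λ} {b : Λ} (hb : b ∈ κ) :
    -b ∈ intDiff σ κ :=
  ⟨0, σ.zero_mem, b, hb, by simp⟩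

lemma intDiff_bot (σ : AddSubmonoid Λ) : intDiff σ ⊥ = σ := by
  refine le_antisymm ?_ (le_intDiff σ ⊥)
  rintro _ ⟨a, ha, b, hb, rfl⟩
  rw [AddSubmonoid.mem_bot] at hb
  simpa [hb] using ha

/-- The canonical map from `Λ` to `ℝ ⊗ Λ`. -/
def toReal : Λ →+ ℝ ⊗[ℤ] Λ where
  toFun a := (1 : ℝ) ⊗ₜ[ℤ] a
  map_zero' := TensorProduct.tmul_zero _ _
  map_add' := TensorProduct.tmul_add _

lemma toReal_mem_realify {σ : AddSubmonoid Λ} {a : Λ} (ha : a ∈ σ) : toReal a ∈ realify σ :=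
  Submodule.subset_span ⟨a, ha, rfl⟩

lemma realify_le {σ : AddSubmonoid Λ} {P : PointedCone ℝ (ℝ ⊗[ℤ] Λ)} :
    realify σ ≤ P ↔ ∀ a ∈ σ, toReal a ∈ P := by
  refine ⟨fun h a ha => h (toReal_mem_realify ha), fun h => Submodule.span_le.2 ?_⟩
  rintro _ ⟨a, ha, rfl⟩
  exact h a ha

/-- The integral points of a real cone `τ` that lie in `σ`. -/
def integralPart (σ : AddSubmonoid Λ) (τ : PointedCone ℝ (ℝ ⊗[ℤ] Λ)) : AddSubmonoid Λ :=
  σ ⊓ τ.toAddSubmonoid.comap toReal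

lemma mem_integralPart {σ : AddSubmonoid Λ} {τ : PointedCone ℝ (ℝ ⊗[ℤ] Λ)} {a : Λ} :
    a ∈ integralPart σ τ ↔ a ∈ σ ∧ toReal a ∈ τ := Iff.rfl

/-- A face of the real cone generated by `σ` is generated by elements of `σ`. -/
lemma realify_integralPart {σ : AddSubmonoid Λ} {τ : PointedCone ℝ (ℝ ⊗[ℤ] Λ)}
    (hτ : τ.IsFaceOf (realify σ)) : realify (integralPart σ τ) = τ := by
  refine le_antisymm (realify_le.2 fun a ha => ha.2) fun x hx => ?_
  have key : ∀ x ∈ realify σ, x ∈ τ → x ∈ realify (integralPart σ τ) := by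
    intro x hx
    induction hx using Submodule.span_induction with
    | mem x h =>
      obtain ⟨a, ha, rfl⟩ := h
      exact fun hτa => toReal_mem_realify (mem_integralPart.2 ⟨ha, hτa⟩)
    | zero => exact fun _ => Submodule.zero_mem _
    | add x y hx hy ihx ihy =>
      intro hxy
      obtain ⟨h₁, h₂⟩ := (hτ.add_mem_iff_mem hx hy).1 hxy
      exact add_mem (ihx h₁) (ihy h₂)
    | smul c x hx ih =>
      intro hcx
      rcases eq_or_lt_of_le c.2 with hc | hc
      · have : c = 0 := Subtype.ext hc.symm
        simp [this]
      · refine Submodule.smul_mem _ c (ih (hτ.mem_of_smul_add_mem hx (Submodule.zero_mem _) hc ?_))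
        rw [add_zero]
        exact hcx
  exact key x (hτ.le hx) hx

lemma realify_intDiff (σ κ : AddSubmonoid Λ) :
    realify (intDiff σ κ) = realDiff (realify σ) (realify κ) := by
  refine le_antisymm (realify_le.2 ?_) ?_
  · rintro _ ⟨a, ha, b, hb, rfl⟩
    exact ⟨_, toReal_mem_realify ha, _, toReal_mem_realify hb, map_sub _ _ _⟩
  · rintro _ ⟨x, hx, y, hy, rfl⟩
    have h₁ : realify σ ≤ realify (intDiff σ κ) :=
      realify_le.2 fun a ha => toReal_mem_realify (le_intDiff σ κ ha)
    have h₂ : realify κ ≤ invertibleFace ⊤ (realify (intDiff σ κ)) := by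
      refine realify_le.2 fun b hb => ⟨trivial, ?_⟩
      rw [← map_neg]
      exact toReal_mem_realify (neg_mem_intDiff σ hb)
    rw [sub_eq_add_neg]
    exact add_mem (h₁ hx) (h₂ hy).2

/-- The functionals which are non-negative on an integral cone. -/
def dualCone (E : AddSubmonoid Λ) : PointedCone ℝ (Λ →+ ℝ) where
  carrier := {f | ∀ x ∈ E, 0 ≤ f x}
  zero_mem' := fun _ _ => le_refl _
  add_mem' := fun hf hg x hx => add_nonneg (hf x hx) (hg x hx)
  smul_mem' := fun c _ hf x hx => mul_nonneg c.2 (hf x hx)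

lemma mem_dualCone {E : AddSubmonoid Λ} {f : Λ →+ ℝ} : f ∈ dualCone E ↔ ∀ x ∈ E, 0 ≤ f x :=
  Iff.rfl

lemma mem_dualCone_closure {s : Set Λ} {f : Λ →+ ℝ} :
    f ∈ dualCone (AddSubmonoid.closure s) ↔ ∀ x ∈ s, 0 ≤ f x := by
  refine ⟨fun h x hx => h x (AddSubmonoid.subset_closure hx), fun h x hx => ?_⟩
  induction hx using AddSubmonoid.closure_induction with
  | mem x hx => exact h x hx
  | zero => simp
  | add x y _ _ hx hy => rw [map_add]; exact add_nonneg hx hy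

lemma dual_realify (E : AddSubmonoid Λ) :
    PointedCone.dual (pairing Λ) (realify E : Set (ℝ ⊗[ℤ] Λ)) = dualCone E := by
  rw [realify, PointedCone.dual_hull]
  ext f
  simp [mem_dualCone, PointedCone.mem_dual]

/-- The dual of a coface is the face on which the inverted elements vanish. -/
lemma dualCone_intDiff_isFaceOf {E κ : AddSubmonoid Λ} (hκ : κ ≤ E) :
    (dualCone (intDiff E κ)).IsFaceOf (dualCone E) := by
  refine isFaceOf_of_add_mem (fun f hf x hx => hf x (le_intDiff E κ hx)) ?_
  rintro f hf g hg hfg _ ⟨a, ha, b, hb, rfl⟩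
  have h := hfg (-b) (neg_mem_intDiff E hb)
  have hfb := hf b (hκ hb)
  have hgb := hg b (hκ hb)
  have hfa := hf a ha
  simp only [AddMonoidHom.add_apply, map_neg] at h
  rw [map_sub]
  linarith

/-- All faces of the dual cones of a family of integral cones. -/
def dualFan (𝓔 : Set (AddSubmonoid Λ)) : Set (PointedCone ℝ (Λ →+ ℝ)) :=
  {τ | ∃ E ∈ 𝓔, τ.IsFaceOf (dualCone E)}

/-- The real cones generated by the cofaces of a family of integral cones. -/
def realCofaces (𝓔 : Set (AddSubmonoid Λ)) : Set (PointedCone ℝ (ℝ ⊗[ℤ] Λ)) :=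
  realify '' {σ | ∃ E ∈ 𝓔, σ ∈ cofaces E}

/-- The family `𝓔` has the splitting property if `E' ⊆ E + (E' ∩ -E)` for all `E, E' ∈ 𝓔`. -/
def HasSplitting (𝓔 : Set (AddSubmonoid Λ)) : Prop :=
  ∀ E ∈ 𝓔, ∀ E' ∈ 𝓔, ∀ x ∈ E', ∃ a ∈ E, ∃ b ∈ E', -b ∈ E ∧ x = a + b

variable {𝓔 : Set (AddSubmonoid Λ)}

lemma HasSplitting.dualCone_inf_isFaceOf (h𝓔 : HasSplitting 𝓔) {E E' : AddSubmonoid Λ}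
    (hE : E ∈ 𝓔) (hE' : E' ∈ 𝓔) : (dualCone E ⊓ dualCone E').IsFaceOf (dualCone E) := by
  refine isFaceOf_of_add_mem inf_le_left fun f hf g hg hfg => ⟨hf, fun x hx => ?_⟩
  obtain ⟨a, ha, b, hb, hb', rfl⟩ := h𝓔 E hE E' hE' x hx
  -- `f` and `g` are non-positive at `b`, and their sum is non-negative there
  have h := hfg.2 b hb
  have hfb := hf _ hb'
  have hgb := hg _ hb'
  have hfa := hf a ha
  simp only [AddMonoidHom.add_apply, map_neg] at h hfb hgb
  rw [map_add]
  linarith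

theorem HasSplitting.isFan (h𝓔 : HasSplitting 𝓔) : IsFan (dualFan 𝓔) where
  face_mem := by
    rintro σ ⟨E, hE, hσ⟩ τ hτ
    exact ⟨E, hE, hτ.trans hσ⟩
  inter_isFaceOf := by
    have key : ∀ σ ∈ dualFan 𝓔, ∀ τ ∈ dualFan 𝓔, (σ ⊓ τ).IsFaceOf σ := by
      rintro σ ⟨E, hE, hσ⟩ τ ⟨E', hE', hτ⟩
      have h := (hσ.inf hτ).trans (h𝓔.dualCone_inf_isFaceOf hE hE')
      exact (h.isFaceOf_iff_le hσ).2 inf_le_left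
    intro σ hσ τ hτ
    exact ⟨key σ hσ τ hτ, inf_comm σ τ ▸ key τ hτ σ hσ⟩

theorem HasSplitting.isCofan (h𝓔 : HasSplitting 𝓔) : IsCofan (realCofaces 𝓔) where
  diff_mem := by
    rintro _ ⟨_, ⟨E, hE, κ, hκ, rfl⟩, rfl⟩ τ hτ
    refine ⟨intDiff E (integralPart E τ), ⟨E, hE, _, inf_le_left, rfl⟩, ?_⟩
    -- the elements of `κ` are invertible in the coface, hence lie in each of its faces
    have hκτ : ∀ b ∈ κ, toReal b ∈ τ := fun b hb =>
      hτ.mem_of_add_mem_left (toReal_mem_realify (le_intDiff E κ (hκ hb)))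
        (toReal_mem_realify (neg_mem_intDiff E hb)) (by
          rw [← map_add, add_neg_cancel, map_zero]; exact τ.zero_mem)
    have heq : intDiff E (integralPart E τ) =
        intDiff (intDiff E κ) (integralPart (intDiff E κ) τ) := by
      refine le_antisymm ?_ ?_
      · rintro _ ⟨a, ha, c, hc, rfl⟩
        exact ⟨a, le_intDiff E κ ha, c, ⟨le_intDiff E κ hc.1, hc.2⟩, rfl⟩
      · rintro _ ⟨_, ⟨a, ha, b, hb, rfl⟩, _, ⟨⟨a', ha', b', hb', rfl⟩, hc⟩, rfl⟩
        refine ⟨a + b', E.add_mem ha (hκ hb'), b + a', ⟨E.add_mem (hκ hb) ha', ?_⟩, by abel⟩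
        have h : toReal a' ∈ τ := by
          have := τ.add_mem hc (hκτ b' hb')
          rwa [← map_add, sub_add_cancel] at this
        change toReal (b + a') ∈ τ
        rw [map_add]
        exact τ.add_mem (hκτ b hb) h
    rw [heq, realify_intDiff, realify_integralPart hτ]
  sum_eq_diff := by
    rintro _ ⟨_, ⟨E, hE, κ, hκ, rfl⟩, rfl⟩ _ ⟨_, ⟨E', hE', κ', hκ', rfl⟩, rfl⟩
    set S := intDiff E κ
    set S' := intDiff E' κ'
    set ρ := realify S ⊔ realify S'
    have hS : E ≤ S := le_intDiff E κ
    have hS' : E' ≤ S' := le_intDiff E' κ'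
    -- the face consists of those elements of the first cone that are invertible in the sum
    refine ⟨invertibleFace (realify S) ρ, invertibleFace_isFaceOf le_sup_left,
      le_antisymm (sup_le (fun x hx => ⟨x, hx, 0, Submodule.zero_mem _, by simp⟩)
        (realify_le.2 ?_)) ?_⟩
    · have hmem : ∀ p ∈ S, ∀ q ∈ S, -q ∈ S' →
          toReal (p - q) ∈ realDiff (realify S) (invertibleFace (realify S) ρ) := by
        intro p hp q hq hq'
        refine ⟨_, toReal_mem_realify hp, _, ⟨toReal_mem_realify hq, ?_⟩, map_sub _ _ _⟩
        rw [← map_neg]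
        exact le_sup_right (α := PointedCone ℝ (ℝ ⊗[ℤ] Λ)) (toReal_mem_realify hq')
      rintro _ ⟨p, hp, q, hq, rfl⟩
      rw [sub_eq_add_neg, map_add]
      refine add_mem ?_ ?_
      · obtain ⟨a, ha, b, hb, hb', rfl⟩ := h𝓔 E hE E' hE' p hp
        have := hmem a (hS ha) (-b) (hS hb') (by simpa using hS' hb)
        rwa [sub_neg_eq_add] at this
      · obtain ⟨a, ha, b, hb, hb', rfl⟩ := h𝓔 E hE E' hE' q (hκ' hq)
        have hna : -a ∈ S' := by
          have := S'.add_mem (neg_mem_intDiff E' hq) (hS' hb)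
          rwa [neg_add, neg_add_cancel_right] at this
        have := hmem (-b) (hS hb') a (hS ha) hna
        rwa [show -b - a = -(a + b) by abel] at this
    · rintro _ ⟨x, hx, y, hy, rfl⟩
      rw [sub_eq_add_neg]
      exact add_mem (le_sup_left (α := PointedCone ℝ (ℝ ⊗[ℤ] Λ)) hx) hy.2

/-- Inverting elements of a cone cuts a face out of its dual, so that the cofaces contribute no
new cones to the associated fan. -/
theorem associatedFan_realCofaces (𝓔 : Set (AddSubmonoid Λ)) :
    associatedFan (realCofaces 𝓔) = dualFan 𝓔 := by
  ext τ
  constructor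
  · rintro ⟨_, ⟨_, ⟨E, hE, κ, hκ, rfl⟩, rfl⟩, hτ⟩
    rw [dual_realify] at hτ
    exact ⟨E, hE, hτ.trans (dualCone_intDiff_isFaceOf hκ)⟩
  · rintro ⟨E, hE, hτ⟩
    refine ⟨realify E, ⟨E, ⟨E, hE, ⊥, bot_le, (intDiff_bot E).symm⟩, rfl⟩, ?_⟩
    rwa [dual_realify]

end Convex

end HeartFan

namespace HeartFan

/-! ### Torsion pairs in abelian categories -/

section TorsionPair

variable {A : Type u} [Category.{v} A]

/-- The objects all of whose quotients have non-negative value under `φ`. -/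
def nonnegQuotients (φ : A → ℝ) : ObjectProperty A :=
  fun X => ∀ ⦃Q : A⦄ (q : X ⟶ Q) [Epi q], 0 ≤ φ Q

lemma nonnegQuotients_of_epi {φ : A → ℝ} {X Y : A} (p : X ⟶ Y) [Epi p]
    (hX : nonnegQuotients φ X) : nonnegQuotients φ Y :=
  fun _ q _ => hX (p ≫ q)

/-- The integral cone generated by the classes of torsion objects and the negatives of the classes
of torsion-free objects; it is the effective cone of the tilted heart. -/
def torsionCone {Λ : Type w} [AddCommGroup Λ] (c : A → Λ) (T F : ObjectProperty A) :
    AddSubmonoid Λ :=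
  AddSubmonoid.closure ({x | ∃ X, T X ∧ x = c X} ∪ {x | ∃ X, F X ∧ x = -c X})

lemma torsion_mem_torsionCone {Λ : Type w} [AddCommGroup Λ] {c : A → Λ} {T F : ObjectProperty A}
    {X : A} (hX : T X) : c X ∈ torsionCone c T F :=
  AddSubmonoid.subset_closure (Or.inl ⟨X, hX, rfl⟩)

lemma neg_free_mem_torsionCone {Λ : Type w} [AddCommGroup Λ] {c : A → Λ}
    {T F : ObjectProperty A} {X : A} (hX : F X) : -c X ∈ torsionCone c T F :=
  AddSubmonoid.subset_closure (Or.inr ⟨X, hX, rfl⟩)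

variable [Abelian A]

/-- A torsion pair in an abelian category: there are no non-zero morphisms from torsion objects to
torsion-free objects, and each object is an extension of a torsion-free object by a torsion
object. -/
structure IsTorsionPair (T F : ObjectProperty A) : Prop where
  torsion_iso : ∀ ⦃X Y : A⦄, (X ≅ Y) → T X → T Y
  free_iso : ∀ ⦃X Y : A⦄, (X ≅ Y) → F X → F Y
  hom_eq_zero : ∀ ⦃X Y : A⦄, T X → F Y → ∀ f : X ⟶ Y, f = 0
  exists_shortExact : ∀ X : A, ∃ (Y Z : A) (f : Y ⟶ X) (g : X ⟶ Z) (w : f ≫ g = 0),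
    (ShortComplex.mk f g w).ShortExact ∧ T Y ∧ F Z

namespace IsTorsionPair

variable {T F : ObjectProperty A}

lemma torsion_of_hom_eq_zero (h : IsTorsionPair T F) {X : A}
    (hX : ∀ ⦃Y : A⦄, F Y → ∀ f : X ⟶ Y, f = 0) : T X := by
  obtain ⟨Y, Z, f, g, w, hS, hY, hZ⟩ := h.exists_shortExact X
  have hf : Mono f := hS.mono_f
  have hf' : Epi f := (ShortComplex.exact_iff_epi _ (hX hZ g)).1 hS.exact
  have : IsIso f := isIso_of_mono_of_epi f
  exact h.torsion_iso (asIso f) hY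

lemma free_of_hom_eq_zero (h : IsTorsionPair T F) {X : A}
    (hX : ∀ ⦃Y : A⦄, T Y → ∀ f : Y ⟶ X, f = 0) : F X := by
  obtain ⟨Y, Z, f, g, w, hS, hY, hZ⟩ := h.exists_shortExact X
  have hg : Epi g := hS.epi_g
  have hg' : Mono g := (ShortComplex.exact_iff_mono _ (hX hY f)).1 hS.exact
  have : IsIso g := isIso_of_mono_of_epi g
  exact h.free_iso (asIso g).symm hZ

lemma torsion_of_epi (h : IsTorsionPair T F) {X Y : A} (p : X ⟶ Y) [Epi p] (hX : T X) : T Y :=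
  h.torsion_of_hom_eq_zero fun Z hZ f => by
    rw [← cancel_epi p, comp_zero]
    exact h.hom_eq_zero hX hZ _

lemma free_of_mono (h : IsTorsionPair T F) {X Y : A} (i : X ⟶ Y) [Mono i] (hY : F Y) : F X :=
  h.free_of_hom_eq_zero fun Z hZ f => by
    rw [← cancel_mono i, zero_comp]
    exact h.hom_eq_zero hZ hY _

lemma torsion_of_isZero (h : IsTorsionPair T F) {X : A} (hX : IsZero X) : T X :=
  h.torsion_of_hom_eq_zero fun _ _ f => hX.eq_of_src f 0

lemma free_of_isZero (h : IsTorsionPair T F) {X : A} (hX : IsZero X) : F X :=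
  h.free_of_hom_eq_zero fun _ _ f => hX.eq_of_tgt f 0

end IsTorsionPair

/-- A function on objects is additive if it is additive on short exact sequences. -/
def IsAdditiveFunction {G : Type*} [AddCommGroup G] (c : A → G) : Prop :=
  ∀ ⦃S : ShortComplex A⦄, S.ShortExact → c S.X₂ = c S.X₁ + c S.X₃

namespace IsAdditiveFunction

variable {G : Type*} [AddCommGroup G] {c : A → G}

lemma eq_add_cokernel (hc : IsAdditiveFunction c) {X Y : A} (i : X ⟶ Y) [Mono i] :
    c Y = c X + c (cokernel i) :=
  hc (ShortComplex.ShortExact.mk' (ShortComplex.exact_cokernel i) inferInstance inferInstance)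

lemma eq_kernel_add (hc : IsAdditiveFunction c) {X Y : A} (p : X ⟶ Y) [Epi p] :
    c X = c (kernel p) + c Y :=
  hc (ShortComplex.ShortExact.mk' (ShortComplex.exact_kernel p) inferInstance inferInstance)

lemma eq_zero_of_isZero (hc : IsAdditiveFunction c) {X : A} (hX : IsZero X) : c X = 0 := by
  have : (ShortComplex.mk (0 : X ⟶ X) (0 : X ⟶ X) (by simp)).ShortExact :=
    ShortComplex.ShortExact.mk' (ShortComplex.exact_of_isZero_X₂ _ hX)
      ⟨fun _ _ _ => hX.eq_of_tgt _ _⟩ ⟨fun _ _ _ => hX.eq_of_src _ _⟩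
  simpa using hc this

lemma eq_of_iso (hc : IsAdditiveFunction c) {X Y : A} (e : X ≅ Y) : c X = c Y := by
  rw [hc.eq_add_cokernel e.hom, hc.eq_zero_of_isZero (isZero_cokernel_of_epi e.hom), add_zero]

end IsAdditiveFunction

section Cones

variable {Λ : Type w} [AddCommGroup Λ] (c : A → Λ)

/-- The integral cones of all torsion pairs. -/
def torsionCones : Set (AddSubmonoid Λ) :=
  {E | ∃ T F : ObjectProperty A, IsTorsionPair T F ∧ E = torsionCone c T F}

variable {c}

/-- Decomposing the torsion and torsion-free objects of one torsion pair with respect to another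
one splits the cone of the first pair: a quotient of a torsion object is torsion, so the
torsion-free part for one pair of a torsion object for the other lies in both classes. -/
lemma hasSplitting_torsionCones (hc : IsAdditiveFunction c) : HasSplitting (torsionCones c) := by
  rintro _ ⟨T, F, h, rfl⟩ _ ⟨T', F', h', rfl⟩ x hx
  induction hx using AddSubmonoid.closure_induction with
  | mem x hx =>
    rcases hx with ⟨X, hX, rfl⟩ | ⟨X, hX, rfl⟩
    · obtain ⟨Y, Z, f, g, w, hS, hY, hZ⟩ := h.exists_shortExact X
      have hg : Epi g := hS.epi_g
      exact ⟨c Y, torsion_mem_torsionCone hY, c Z,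
        torsion_mem_torsionCone (h'.torsion_of_epi g hX), neg_free_mem_torsionCone hZ, hc hS⟩
    · obtain ⟨Y, Z, f, g, w, hS, hY, hZ⟩ := h.exists_shortExact X
      have hf : Mono f := hS.mono_f
      refine ⟨-c Z, neg_free_mem_torsionCone hZ, -c Y,
        neg_free_mem_torsionCone (h'.free_of_mono f hX), ?_, ?_⟩
      · rw [neg_neg]
        exact torsion_mem_torsionCone hY
      · rw [hc hS]
        exact neg_add_rev _ _
  | zero => exact ⟨0, zero_mem _, 0, zero_mem _, by simp, by simp⟩
  | add x y _ _ hx hy =>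
    obtain ⟨a, ha, b, hb, hb', rfl⟩ := hx
    obtain ⟨a', ha', b', hb', hb'', rfl⟩ := hy
    refine ⟨a + a', add_mem ha ha', b + b', add_mem hb hb', ?_, by abel⟩
    rw [neg_add]
    exact add_mem ‹_› ‹_›

/-- An equivalence of abelian categories that respects the classes carries the cones of torsion
pairs of its target to such cones of its source. -/
lemma torsionCones_subset_of_equivalence {B : Type u'} [Category.{v'} B] [Abelian B]
    {c' : B → Λ} (hc' : IsAdditiveFunction c') (e : A ≌ B) (hce : ∀ X, c' (e.functor.obj X) = c X) :
    torsionCones c' ⊆ torsionCones c := by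
  rintro _ ⟨T, F, h, rfl⟩
  refine ⟨T.inverseImage e.functor, F.inverseImage e.functor, ⟨?_, ?_, ?_, ?_⟩, ?_⟩
  · exact fun X Y i hX => h.torsion_iso (e.functor.mapIso i) hX
  · exact fun X Y i hX => h.free_iso (e.functor.mapIso i) hX
  · intro X Y hX hY f
    apply e.functor.map_injective
    rw [Functor.map_zero]
    exact h.hom_eq_zero hX hY _
  · intro X
    obtain ⟨Y, Z, f, g, w, hS, hY, hZ⟩ := h.exists_shortExact (e.functor.obj X)
    let i := e.unitIso.app X
    have hS' := hS.map_of_exact e.inverse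
    refine ⟨e.inverse.obj Y, e.inverse.obj Z, e.inverse.map f ≫ i.inv, i.hom ≫ e.inverse.map g,
      by simp [← Functor.map_comp, w], ?_,
      h.torsion_iso (e.counitIso.app Y).symm hY, h.free_iso (e.counitIso.app Z).symm hZ⟩
    refine ShortComplex.shortExact_of_iso (S₁ := ShortComplex.mk (e.inverse.map f)
      (e.inverse.map g) (by rw [← Functor.map_comp, w, Functor.map_zero]))
      (ShortComplex.isoMk (Iso.refl _) i.symm (Iso.refl _) ?_ ?_) hS'
    · exact Category.id_comp _
    · exact (i.inv_hom_id_assoc _).trans (Category.comp_id _).symm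
  · have h₁ : ∀ X, c' X = c (e.inverse.obj X) := fun X => by
      rw [← hce]
      exact (hc'.eq_of_iso (e.counitIso.app X)).symm
    unfold torsionCone
    congr 2
    · ext x
      constructor
      · rintro ⟨X, hX, rfl⟩
        exact ⟨e.inverse.obj X, h.torsion_iso (e.counitIso.app X).symm hX, h₁ X⟩
      · rintro ⟨X, hX, rfl⟩
        exact ⟨_, hX, (hce X).symm⟩
    · ext x
      constructor
      · rintro ⟨X, hX, rfl⟩
        exact ⟨e.inverse.obj X, h.free_iso (e.counitIso.app X).symm hX, by rw [h₁ X]⟩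
      · rintro ⟨X, hX, rfl⟩
        exact ⟨_, hX, by rw [hce X]⟩

end Cones

section Stability

variable {φ : A → ℝ}

lemma nonnegQuotients_of_shortExact (hφ : IsAdditiveFunction φ) {S : ShortComplex A}
    (hS : S.ShortExact) (h₁ : nonnegQuotients φ S.X₁) (h₃ : nonnegQuotients φ S.X₃) :
    nonnegQuotients φ S.X₂ := by
  intro Q q hq
  have hg : Epi S.g := hS.epi_g
  -- filter `Q` by the image of the subobject
  let d : S.X₃ ⟶ cokernel (image.ι (S.f ≫ q)) :=
    hS.exact.desc (q ≫ cokernel.π (image.ι (S.f ≫ q))) (by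
      rw [← Category.assoc]
      conv_lhs => enter [1]; rw [← image.fac (S.f ≫ q)]
      rw [Category.assoc, cokernel.condition, comp_zero])
  have hd : Epi d := by
    have : Epi (S.g ≫ d) := by
      rw [show S.g ≫ d = q ≫ cokernel.π (image.ι (S.f ≫ q)) from hS.exact.g_desc _ _]
      infer_instance
    exact epi_of_epi S.g d
  rw [hφ.eq_add_cokernel (image.ι (S.f ≫ q))]
  exact add_nonneg (h₁ (factorThruImage (S.f ≫ q))) (h₃ d)

/-- An artinian object of positive value has a minimal subobject of positive value, all of whose
quotients have non-negative value; so it receives a non-zero morphism from such an object. -/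
lemma nonpos_of_hom_eq_zero (hφ : IsAdditiveFunction φ) (Y : A) [IsArtinianObject Y]
    (hY : ∀ ⦃X : A⦄, nonnegQuotients φ X → ∀ f : X ⟶ Y, f = 0) : φ Y ≤ 0 := by
  by_contra! hpos
  obtain ⟨s, hs, hmin⟩ := WellFounded.has_min (wellFounded_lt (α := Subobject Y))
    {s | 0 < φ (s : A)}
    ⟨⊤, by
      change 0 < φ ((⊤ : Subobject Y) : A)
      rwa [hφ.eq_of_iso (asIso (⊤ : Subobject Y).arrow)]⟩
  change 0 < φ (s : A) at hs
  have hT : nonnegQuotients φ (s : A) := by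
    intro Q q hq
    by_contra! hneg
    have hk := hφ.eq_kernel_add q
    have hiso := hφ.eq_of_iso (Subobject.underlyingIso (kernel.ι q ≫ s.arrow))
    have hle : Subobject.mk (kernel.ι q ≫ s.arrow) ≤ s :=
      Subobject.mk_le_of_comm (kernel.ι q) rfl
    rcases hle.eq_or_lt with heq | hlt
    · rw [heq] at hiso
      linarith
    · exact hmin _ (show 0 < φ _ by linarith) hlt
  have hz : s.arrow = 0 := hY hT _
  have : IsZero (s : A) := by
    rw [IsZero.iff_id_eq_zero, ← cancel_mono s.arrow, hz, comp_zero, comp_zero]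
  rw [hφ.eq_zero_of_isZero this] at hs
  exact lt_irrefl _ hs

/-- A noetherian object has a largest subobject all of whose quotients have non-negative value, and
the quotient by it receives no non-zero morphism from such an object. -/
lemma exists_shortExact_nonnegQuotients (hφ : IsAdditiveFunction φ) (X : A)
    [IsNoetherianObject X] :
    ∃ (Y Z : A) (f : Y ⟶ X) (g : X ⟶ Z) (w : f ≫ g = 0),
      (ShortComplex.mk f g w).ShortExact ∧ nonnegQuotients φ Y ∧
        ∀ ⦃W : A⦄, nonnegQuotients φ W → ∀ f : W ⟶ Z, f = 0 := by
  obtain ⟨M, hM, hmax⟩ := WellFounded.has_min (wellFounded_gt (α := Subobject X))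
    {s | nonnegQuotients φ (s : A)}
    ⟨⊥, fun Q q hq => by
      have h0 : IsZero ((⊥ : Subobject X) : A) :=
        (isZero_zero A).of_iso Subobject.botCoeIsoZero
      have : IsZero Q := by
        rw [IsZero.iff_id_eq_zero, ← cancel_epi q]
        exact h0.eq_of_src _ _
      rw [hφ.eq_zero_of_isZero this]⟩
  change nonnegQuotients φ (M : A) at hM
  have hS : (ShortComplex.mk M.arrow (cokernel.π M.arrow) (cokernel.condition _)).ShortExact :=
    ShortComplex.ShortExact.mk' (ShortComplex.exact_cokernel _) inferInstance inferInstance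
  refine ⟨_, _, M.arrow, cokernel.π M.arrow, cokernel.condition _, hS, hM, fun W hW h => ?_⟩
  -- the pullback of `h` is an extension of `W` by `M`, and its image in `X` contains `M`,
  -- hence equals `M` by maximality
  let p := cokernel.π M.arrow
  let m : (M : A) ⟶ pullback p h := pullback.lift M.arrow 0 (by simp [p])
  have hmf : m ≫ pullback.fst p h = M.arrow := pullback.lift_fst _ _ _
  have hms : m ≫ pullback.snd p h = 0 := pullback.lift_snd _ _ _
  have hP : (ShortComplex.mk m (pullback.snd p h) hms).ShortExact := by
    have hm : Mono m := by
      have : Mono (m ≫ pullback.fst p h) := by rw [hmf]; infer_instance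
      exact mono_of_mono m (pullback.fst p h)
    refine ShortComplex.ShortExact.mk' ?_ hm inferInstance
    refine ShortComplex.exact_of_f_is_kernel _ (KernelFork.IsLimit.ofι' _ _ fun {V} k hk => ?_)
    have hk' : (k ≫ pullback.fst p h) ≫ p = 0 := by
      rw [Category.assoc, pullback.condition, ← Category.assoc, hk, zero_comp]
    have : Mono (ShortComplex.mk M.arrow (cokernel.π M.arrow) (cokernel.condition _)).f :=
      hS.mono_f
    refine ⟨hS.exact.lift (k ≫ pullback.fst p h) hk', ?_⟩
    have hl := hS.exact.lift_f (k ≫ pullback.fst p h) hk'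
    apply pullback.hom_ext
    · rw [Category.assoc, hmf]
      exact hl
    · rw [Category.assoc, hms, comp_zero]
      exact hk.symm
  have hI : nonnegQuotients φ (image (pullback.fst p h)) :=
    nonnegQuotients_of_epi (factorThruImage _) (nonnegQuotients_of_shortExact hφ hP hM hW)
  have hle : M ≤ Subobject.mk (image.ι (pullback.fst p h)) :=
    Subobject.le_mk_of_comm (m ≫ factorThruImage _) (by rw [Category.assoc, image.fac, hmf])
  have hmem : nonnegQuotients φ (Subobject.mk (image.ι (pullback.fst p h)) : A) :=
    nonnegQuotients_of_epi (Subobject.underlyingIso _).inv hI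
  have heq : M = Subobject.mk (image.ι (pullback.fst p h)) :=
    hle.eq_of_not_lt (hmax _ hmem)
  have hfac : image.ι (pullback.fst p h) ≫ p = 0 := by
    rw [← Subobject.ofMkLE_arrow (h := heq.ge), Category.assoc, cokernel.condition, comp_zero]
  rw [← cancel_epi (pullback.snd p h), comp_zero, ← pullback.condition,
    ← image.fac (pullback.fst p h), Category.assoc, hfac, comp_zero]

/-- In a length category, each additive real-valued function is non-negative on the torsion class
and non-positive on the torsion-free class of some torsion pair. -/
theorem exists_torsionPair_of_isLength (hA : IsLength A) (hφ : IsAdditiveFunction φ) :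
    ∃ T F : ObjectProperty A, IsTorsionPair T F ∧ (∀ X, T X → 0 ≤ φ X) ∧
      ∀ X, F X → φ X ≤ 0 := by
  refine ⟨nonnegQuotients φ, fun Y => ∀ ⦃X : A⦄, nonnegQuotients φ X → ∀ f : X ⟶ Y, f = 0,
    ⟨?_, ?_, ?_, ?_⟩, fun X hX => hX (𝟙 X), ?_⟩
  · exact fun X Y e hX => nonnegQuotients_of_epi e.hom hX
  · intro X Y e hX Z hZ f
    rw [← cancel_mono e.inv, zero_comp]
    exact hX hZ _
  · exact fun X Y hX hY f => hY hX f
  · intro X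
    have := (hA X).1
    exact exists_shortExact_nonnegQuotients hφ X
  · intro Y hY
    have := (hA Y).2
    exact nonpos_of_hom_eq_zero hφ Y hY

end Stability

end TorsionPair

end HeartFan

namespace HeartFan

/-! ### The heart of a t-structure as an abelian category -/

section Heart

open scoped ZeroObject

variable {D : Type u} [Category.{v} D] [Preadditive D] [HasZeroObject D] [HasShift D ℤ]
  [∀ n : ℤ, (shiftFunctor D n).Additive] [Pretriangulated D]

lemma isGE_obj₁ (t : TStructure D) {T : Triangle D} (hT : T ∈ distTriang D) (n : ℤ)
    (h₂ : t.IsGE T.obj₂ n) (h₃ : t.IsGE T.obj₃ (n - 1)) : t.IsGE T.obj₁ n :=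
  t.isGE₂ _ (inv_rot_of_distTriang _ hT) n (t.isGE_shift T.obj₃ (n - 1) (-1) n) h₂

lemma isLE_obj₃ (t : TStructure D) {T : Triangle D} (hT : T ∈ distTriang D) (n : ℤ)
    (h₂ : t.IsLE T.obj₂ n) (h₁ : t.IsLE T.obj₁ (n + 1)) : t.IsLE T.obj₃ n :=
  t.isLE₂ _ (rot_of_distTriang _ hT) n h₂ (t.isLE_shift T.obj₁ (n + 1) 1 n)

lemma distTriang_of_iso_obj₁ {X X' Y Z : D} {f : X ⟶ Y} {g : Y ⟶ Z} {h : Z ⟶ X⟦(1 : ℤ)⟧}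
    (hT : Triangle.mk f g h ∈ distTriang D) (e : X' ≅ X) :
    Triangle.mk (e.hom ≫ f) g (h ≫ e.inv⟦(1 : ℤ)⟧') ∈ distTriang D := by
  refine isomorphic_distinguished _ hT _
    (Triangle.isoMk _ _ e (Iso.refl _) (Iso.refl _) (Category.comp_id _)
      ((Category.comp_id _).trans (Category.id_comp _).symm) ?_)
  change (h ≫ e.inv⟦(1 : ℤ)⟧') ≫ e.hom⟦(1 : ℤ)⟧' = 𝟙 _ ≫ h
  rw [Category.assoc, ← Functor.map_comp, e.inv_hom_id, CategoryTheory.Functor.map_id,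
    Category.comp_id, Category.id_comp]

lemma K₀.mk_obj₂ {T : Triangle D} (hT : T ∈ distTriang D) :
    K₀.mk T.obj₂ = K₀.mk T.obj₁ + K₀.mk T.obj₃ := by
  have h : FreeAbelianGroup.of T.obj₂ -
      (FreeAbelianGroup.of T.obj₁ + FreeAbelianGroup.of T.obj₃) ∈
      AddSubgroup.closure {x : FreeAbelianGroup D | ∃ T ∈ distTriang D,
        x = FreeAbelianGroup.of T.obj₂ -
          (FreeAbelianGroup.of T.obj₁ + FreeAbelianGroup.of T.obj₃)} :=
    AddSubgroup.subset_closure ⟨T, hT, rfl⟩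
  rw [← QuotientAddGroup.eq_zero_iff, QuotientAddGroup.mk_sub, sub_eq_zero] at h
  exact h

lemma K₀.mk_of_isZero {X : D} (hX : IsZero X) : K₀.mk X = 0 := by
  have h := K₀.mk_obj₂ (contractible_distinguished X)
  have h' := K₀.mk_obj₂ (contractible_distinguished (0 : D))
  simp only [contractibleTriangle_obj₁, contractibleTriangle_obj₂,
    contractibleTriangle_obj₃, left_eq_add] at h h'
  have e : Triangle.mk (0 : (0 : D) ⟶ X) (0 : X ⟶ 0) 0 ∈ distTriang D :=
    (Triangle.distinguished_iff_of_isZero₃ _ (isZero_zero D)).2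
      ⟨0, (isZero_zero D).eq_of_src _ _, hX.eq_of_src _ _⟩
  simpa [h'] using K₀.mk_obj₂ e

lemma K₀.mk_shift_one (X : D) : K₀.mk (X⟦(1 : ℤ)⟧) = -K₀.mk X := by
  have h := K₀.mk_obj₂ (rot_of_distTriang _ (contractible_distinguished X))
  simp only [Triangle.rotate_obj₁, Triangle.rotate_obj₂, Triangle.rotate_obj₃,
    contractibleTriangle_obj₁, contractibleTriangle_obj₂, contractibleTriangle_obj₃,
    K₀.mk_of_isZero (isZero_zero D)] at h
  exact eq_neg_of_add_eq_zero_right h.symm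

lemma K₀.mk_of_iso {X Y : D} (e : X ≅ Y) : K₀.mk X = K₀.mk Y := by
  obtain ⟨Z, g, h, hT⟩ := distinguished_cocone_triangle e.hom
  have hZ : IsZero Z := (Triangle.isZero₃_iff_isIso₁ _ hT).2 (inferInstanceAs (IsIso e.hom))
  have := K₀.mk_obj₂ hT
  simpa [K₀.mk_of_isZero hZ] using this.symm

lemma K₀.mk_shift_neg_one (X : D) : K₀.mk (X⟦(-1 : ℤ)⟧) = -K₀.mk X := by
  have h := K₀.mk_shift_one (X⟦(-1 : ℤ)⟧)
  rw [K₀.mk_of_iso (shiftNegShift X (1 : ℤ))] at h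
  rw [h, neg_neg]

lemma ext_hom_of_K₀ {Λ : Type w} [AddCommGroup Λ] {f g : K₀ D →+ Λ}
    (h : ∀ X, f (K₀.mk X) = g (K₀.mk X)) : f = g := by
  apply QuotientAddGroup.addMonoidHom_ext
  ext X
  exact h X

variable (t : TStructure D)

instance (X : t.heart.FullSubcategory) : t.IsLE X.obj 0 := ((t.mem_heart_iff _).1 X.property).1

instance (X : t.heart.FullSubcategory) : t.IsGE X.obj 0 := ((t.mem_heart_iff _).1 X.property).2

lemma heart_hom_shift_eq_zero ⦃X Y : t.heart.FullSubcategory⦄ ⦃n : ℤ⦄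
    (f : t.heart.ι.obj X ⟶ (t.heart.ι.obj Y)⟦n⟧) (hn : n < 0) : f = 0 :=
  t.zero_of_isLE_of_isGE f 0 (-n) (by lia) (inferInstanceAs (t.IsLE X.obj 0))
    (t.isGE_shift Y.obj 0 n (-n))

/-- An object in degrees `[-1, 0]` is an extension of an object of the heart by a shifted one. -/
lemma exists_heart_triangle {X : D} (hX : t.IsLE X 0) (hX' : t.IsGE X (-1)) :
    ∃ (K Q : t.heart.FullSubcategory) (f : K.obj⟦(1 : ℤ)⟧ ⟶ X) (g : X ⟶ Q.obj)
      (h : Q.obj ⟶ K.obj⟦(1 : ℤ)⟧⟦(1 : ℤ)⟧), Triangle.mk f g h ∈ distTriang D := by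
  obtain ⟨Y, Z, hY, hZ, f, g, h, hT⟩ := t.exists_triangle X (-1) 0 (by lia)
  have hY' : t.IsLE Y (-1) := ⟨hY⟩
  have hZ' : t.IsGE Z 0 := ⟨hZ⟩
  have hYGE : t.IsGE Y (-1) := isGE_obj₁ t hT (-1) hX' (t.isGE_of_ge Z _ 0)
  have hZLE : t.IsLE Z 0 := isLE_obj₃ t hT 0 hX (t.isLE_of_le Y (-1) _)
  refine ⟨⟨Y⟦(-1 : ℤ)⟧, (t.mem_heart_iff _).2 ⟨t.isLE_shift Y (-1) (-1) 0,
    t.isGE_shift Y (-1) (-1) 0⟩⟩, ⟨Z, (t.mem_heart_iff _).2 ⟨hZLE, hZ'⟩⟩,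
    _, _, _, distTriang_of_iso_obj₁ hT (shiftNegShift Y 1)⟩

lemma admissibleMorphism_heart : AbelianSubcategory.admissibleMorphism t.heart.ι = ⊤ := by
  ext X₁ X₂ f₁
  simp only [MorphismProperty.top_apply, iff_true]
  intro X₃ f₂ f₃ hT
  have h₁ : t.IsLE X₁.obj 0 := inferInstance
  have h₂ : t.IsGE X₂.obj 0 := inferInstance
  have hLE : t.IsLE X₃ 0 := isLE_obj₃ t hT 0 (inferInstanceAs (t.IsLE X₂.obj 0))
    (t.isLE_of_le X₁.obj 0 _)
  have hGE : t.IsGE X₃ (-1) := t.isGE₂ _ (rot_of_distTriang _ hT) (-1)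
    (t.isGE_of_ge X₂.obj (-1) 0) (t.isGE_shift X₁.obj 0 1 (-1))
  exact exists_heart_triangle t hLE hGE

instance : t.heart.IsTriangulatedClosed₂ :=
  .mk' fun T hT h₁ h₃ => (t.mem_heart_iff _).2
    ⟨t.isLE₂ T hT 0 ((t.mem_heart_iff _).1 h₁).1 ((t.mem_heart_iff _).1 h₃).1,
      t.isGE₂ T hT 0 ((t.mem_heart_iff _).1 h₁).2 ((t.mem_heart_iff _).1 h₃).2⟩

instance : t.heart.ContainsZero :=
  ⟨0, isZero_zero D, (t.mem_heart_iff _).2 ⟨inferInstance, inferInstance⟩⟩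

instance : t.heart.IsClosedUnderBinaryProducts where
  limitsOfShape_le := by
    rintro X ⟨p⟩
    refine t.heart.prop_of_iso ?_ (t.heart.ext_of_isTriangulatedClosed₂ _
      (binaryProductTriangle_distinguished _ _)
      (p.prop_diag_obj (.mk .left)) (p.prop_diag_obj (.mk .right)))
    exact IsLimit.conePointUniqueUpToIso (prodIsProd _ _)
      ((IsLimit.postcomposeHomEquiv (diagramIsoPair p.diag) _).2 p.isLimit)

instance : t.heart.IsClosedUnderFiniteProducts := .mk'

noncomputable instance [IsTriangulated D] : Abelian t.heart.FullSubcategory :=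
  AbelianSubcategory.abelian t.heart.ι (heart_hom_shift_eq_zero t) (admissibleMorphism_heart t)

variable [IsTriangulated D]

variable {t} in
/-- A distinguished triangle with objects in the heart is a short exact sequence there. -/
lemma shortExact_of_distTriang {X₁ X₂ X₃ : t.heart.FullSubcategory} (f : X₁ ⟶ X₂) (g : X₂ ⟶ X₃)
    {h : X₃.obj ⟶ X₁.obj⟦(1 : ℤ)⟧} (hT : Triangle.mk f.hom g.hom h ∈ distTriang D) :
    ∃ w : f ≫ g = 0, (ShortComplex.mk f g w).ShortExact := by
  have h₁ := AbelianSubcategory.isLimitKernelForkOfDistTriang (ι := t.heart.ι)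
    (heart_hom_shift_eq_zero t) f g h hT
  have h₂ := AbelianSubcategory.isColimitCokernelCoforkOfDistTriang (ι := t.heart.ι)
    (heart_hom_shift_eq_zero t) f g h hT
  have w : f ≫ g = 0 :=
    ObjectProperty.hom_ext _ (comp_distTriang_mor_zero₁₂ _ hT)
  refine ⟨w, ShortComplex.ShortExact.mk' (S := ShortComplex.mk f g w)
    (ShortComplex.exact_of_f_is_kernel _ h₁)
    (mono_of_isLimit_fork h₁) (epi_of_isColimit_cofork h₂)⟩

variable {t} in
/-- A short exact sequence in the heart underlies a distinguished triangle. -/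
lemma exists_distTriang_of_shortExact {S : ShortComplex t.heart.FullSubcategory}
    (hS : S.ShortExact) :
    ∃ h : S.X₃.obj ⟶ S.X₁.obj⟦(1 : ℤ)⟧,
      Triangle.mk S.f.hom S.g.hom h ∈ distTriang D := by
  have := hS.epi_g
  have := hS.mono_f
  obtain ⟨K, i, δ, hT⟩ := AbelianSubcategory.exists_distinguished_triangle_of_epi
    (heart_hom_shift_eq_zero t) (admissibleMorphism_heart t) S.g
  have hK := AbelianSubcategory.isLimitKernelForkOfDistTriang (ι := t.heart.ι)
    (heart_hom_shift_eq_zero t) i S.g δ hT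
  -- both `S.X₁` and `K` are kernels of `S.g`
  let e : S.X₁ ≅ K := IsLimit.conePointUniqueUpToIso hS.exact.fIsKernel hK
  have he : e.hom ≫ i = S.f :=
    IsLimit.conePointUniqueUpToIso_hom_comp hS.exact.fIsKernel hK WalkingParallelPair.zero
  let e' : S.X₁.obj ≅ K.obj := t.heart.ι.mapIso e
  have he' : e'.hom ≫ i.hom = S.f.hom := congrArg (fun f => f.hom) he
  refine ⟨δ ≫ e'.inv⟦(1 : ℤ)⟧', ?_⟩
  rw [← he']
  exact distTriang_of_iso_obj₁ hT e'

variable {Λ : Type w} [AddCommGroup Λ]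

/-- The class in `Λ` of an object of the heart. -/
def heartClass (l : K₀ D →+ Λ) (X : t.heart.FullSubcategory) : Λ := l (K₀.mk X.obj)

lemma isAdditiveFunction_heartClass (l : K₀ D →+ Λ) :
    IsAdditiveFunction (heartClass t l) := by
  intro S hS
  obtain ⟨h, hT⟩ := exists_distTriang_of_shortExact hS
  rw [heartClass, heartClass, heartClass, ← map_add]
  exact congrArg l (K₀.mk_obj₂ hT)

end Heart

end HeartFan

namespace HeartFan

/-! ### Tilting at a torsion pair -/

section Tilting

open scoped ZeroObject

variable {D : Type u} [Category.{v} D] [Preadditive D] [HasZeroObject D] [HasShift D ℤ]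
  [∀ n : ℤ, (shiftFunctor D n).Additive] [Pretriangulated D]

lemma HeartLE.ge_le {t k : TStructure D} (h : HeartLE t k) (n : ℤ) : t.ge n ≤ k.ge n := by
  rw [← t.shift_ge (n - 1) 1 n (by lia), ← k.shift_ge (n - 1) 1 n (by lia)]
  exact fun X hX => h _ hX

lemma HeartLE.le_le {t k : TStructure D} (h : HeartLE t k) (n : ℤ) : k.le n ≤ t.le n := by
  intro X hX
  rw [t.le_iff_isLE, t.isLE_iff_orthogonal n (n + 1) rfl]
  exact fun Y f hY =>
    k.zero_of_isLE_of_isGE f n (n + 1) (by lia) ⟨hX⟩ ⟨h.ge_le (n + 1) _ hY.ge⟩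

lemma IsTwoTerm.ge_sub_one {t k : TStructure D} (h : IsTwoTerm t k) (n : ℤ) :
    k.ge n ≤ t.ge (n - 1) :=
  h.le.ge_le n

lemma IsTwoTerm.le_sub_one {t k : TStructure D} (h : IsTwoTerm t k) (n : ℤ) :
    t.le (n - 1) ≤ k.le n :=
  h.le.le_le n

lemma isBounded_of_heartLE {t k : TStructure D} (ht : IsBounded t) (h₁ : HeartLE t k)
    (h₂ : HeartLE k (shiftOne t)) : IsBounded k := by
  refine eq_top_iff.2 fun X _ => ?_
  have hX : t.bounded X := by rw [show t.bounded = ⊤ from ht]; trivial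
  obtain ⟨⟨n, hn⟩, ⟨m, hm⟩⟩ := hX
  exact ⟨⟨n, ⟨h₁.ge_le n _ hn.ge⟩⟩, ⟨m + 1, ⟨h₂.le_le (m + 1) _
    (show t.le (m + 1 - 1) X by rw [add_sub_cancel_right]; exact hm.le)⟩⟩⟩

variable (t : TStructure D)

/-- A class of objects of the heart, seen as a class of objects of the ambient category. -/
def ofHeart (P : ObjectProperty t.heart.FullSubcategory) : ObjectProperty D :=
  fun X => ∃ h : t.heart X, P ⟨X, h⟩

/-- The aisle of the tilt: extensions of objects of the torsion class by objects in negative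
degrees. -/
def tiltLE (T : ObjectProperty t.heart.FullSubcategory) : ObjectProperty D :=
  (t.le (-1)).extensionProduct (ofHeart t T)

/-- The co-aisle of the tilt: extensions of objects in positive degrees by objects of the
torsion-free class. -/
def tiltGE (F : ObjectProperty t.heart.FullSubcategory) : ObjectProperty D :=
  (ofHeart t F).extensionProduct (t.ge 1)

instance (T : ObjectProperty t.heart.FullSubcategory) :
    (tiltLE t T).IsClosedUnderIsomorphisms := by
  unfold tiltLE
  infer_instance

instance (F : ObjectProperty t.heart.FullSubcategory) :
    (tiltGE t F).IsClosedUnderIsomorphisms := by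
  unfold tiltGE
  infer_instance

lemma tiltLE_le (T : ObjectProperty t.heart.FullSubcategory) : tiltLE t T ≤ t.le 0 := by
  rintro X ⟨Y, Z, f, g, h, hT, hY, hZ, -⟩
  exact (t.isLE₂ _ hT 0 ⟨t.le_monotone (by lia : (-1 : ℤ) ≤ 0) _ hY⟩ ⟨hZ.1⟩).le

lemma tiltGE_le (F : ObjectProperty t.heart.FullSubcategory) : tiltGE t F ≤ t.ge 0 := by
  rintro X ⟨Y, Z, f, g, h, hT, ⟨hY, -⟩, hZ⟩
  exact (t.isGE₂ _ hT 0 ⟨hY.2⟩ ⟨t.ge_antitone (by lia : (0 : ℤ) ≤ 1) _ hZ⟩).ge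

lemma isZero_heart_zero :
    IsZero (⟨0, (t.mem_heart_iff _).2 ⟨inferInstance, inferInstance⟩⟩ :
      t.heart.FullSubcategory) := by
  rw [IsZero.iff_id_eq_zero]
  exact ObjectProperty.hom_ext _ ((isZero_zero D).eq_of_src _ _)

lemma ofHeart_le_tiltLE {t : TStructure D} (T : ObjectProperty t.heart.FullSubcategory) :
    ofHeart t T ≤ tiltLE t T := by
  have : (t.le (-1)).ContainsZero := ⟨0, isZero_zero D, (inferInstance : t.IsLE 0 (-1)).le⟩
  exact ObjectProperty.le_extensionProduct_right _

lemma ofHeart_le_tiltGE {t : TStructure D} (F : ObjectProperty t.heart.FullSubcategory) :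
    ofHeart t F ≤ tiltGE t F := by
  have : (t.ge 1).ContainsZero := ⟨0, isZero_zero D, (inferInstance : t.IsGE 0 1).ge⟩
  exact ObjectProperty.le_extensionProduct_left _

variable {Λ : Type w} [AddCommGroup Λ]

lemma IsTwoTerm.effectiveCone_eq {t : TStructure D}
    (l : K₀ D →+ Λ) {k : TStructure D} (hk : IsTwoTerm t k) :
    effectiveCone l k.heart = torsionCone (heartClass t l)
      (fun X : t.heart.FullSubcategory => k.le 0 X.obj)
      (fun X : t.heart.FullSubcategory => k.ge 1 X.obj) := by
  apply le_antisymm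
  · refine AddSubmonoid.closure_le.2 ?_
    rintro _ ⟨X, hX, rfl⟩
    have hXLE : t.IsLE X 0 := ⟨hk.ge.le_le 0 _ hX.1⟩
    have hXGE : t.IsGE X (-1) := ⟨hk.ge_sub_one 0 _ hX.2⟩
    obtain ⟨K, Q, f, g, d, hd⟩ := exists_heart_triangle t hXLE hXGE
    -- `K⟦1⟧` is in the co-aisle and `Q` is in the aisle of `k`
    have hK : k.IsGE (K.obj⟦(1 : ℤ)⟧) 0 := by
      refine isGE_obj₁ k hd 0 ⟨hX.2⟩ ⟨hk.ge.ge_le _ _ ?_⟩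
      exact t.ge_antitone (by lia : (0 : ℤ) - 1 ≤ 0) _ Q.property.2
    have hQ : k.IsLE Q.obj 0 := by
      refine isLE_obj₃ k hd 0 ⟨hX.1⟩ ⟨hk.le_sub_one _ _ ?_⟩
      have := t.isLE_shift K.obj 0 1 (-1)
      exact (t.isLE_of_le (K.obj⟦(1 : ℤ)⟧) (-1) (0 + 1 - 1)).le
    have hcl : l (K₀.mk X) = -heartClass t l K + heartClass t l Q := by
      have h := K₀.mk_obj₂ hd
      change K₀.mk X = K₀.mk (K.obj⟦(1 : ℤ)⟧) + K₀.mk Q.obj at h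
      rw [h, K₀.mk_shift_one, map_add, map_neg]
      rfl
    rw [hcl]
    exact add_mem (neg_free_mem_torsionCone (k.isGE_of_shift K.obj 1 1 0).ge)
      (torsion_mem_torsionCone hQ.le)
  · refine AddSubmonoid.closure_le.2 ?_
    rintro _ (⟨X, hX, rfl⟩ | ⟨X, hX, rfl⟩)
    · exact AddSubmonoid.subset_closure ⟨X.obj, ⟨hX, hk.ge.ge_le 0 _ X.property.2⟩, rfl⟩
    · refine AddSubmonoid.subset_closure ⟨X.obj⟦(1 : ℤ)⟧, ⟨?_, ?_⟩, ?_⟩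
      · exact hk.le_sub_one 0 _ (t.le_shift 0 1 (0 - 1) (by lia) _ X.property.1)
      · exact k.ge_shift 1 1 0 (by lia) _ hX
      · rw [K₀.mk_shift_one, map_neg]
        rfl

lemma heartCone_eq_dualCone (l : K₀ D →+ Λ) (P : ObjectProperty D) :
    heartCone l P = dualCone (effectiveCone l P) := by
  ext f
  rw [effectiveCone, mem_dualCone_closure]
  exact ⟨by rintro h _ ⟨X, hX, rfl⟩; exact h X hX, fun h X hX => h _ ⟨X, hX, rfl⟩⟩

variable [IsTriangulated D]

variable {t} {T F : ObjectProperty t.heart.FullSubcategory}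

lemma le_tiltLE (h : IsTorsionPair T F) : t.le (-1) ≤ tiltLE t T := by
  have : (ofHeart t T).ContainsZero :=
    ⟨0, isZero_zero D, _, h.torsion_of_isZero (isZero_heart_zero t)⟩
  exact ObjectProperty.le_extensionProduct_left _

lemma le_tiltGE (h : IsTorsionPair T F) : t.ge 1 ≤ tiltGE t F := by
  have : (ofHeart t F).ContainsZero :=
    ⟨0, isZero_zero D, _, h.free_of_isZero (isZero_heart_zero t)⟩
  exact ObjectProperty.le_extensionProduct_right _

lemma tilt_hom_eq_zero (h : IsTorsionPair T F) {X Y : D} (hX : tiltLE t T X)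
    (hY : tiltGE t F Y) (φ : X ⟶ Y) : φ = 0 := by
  -- objects of the torsion class have no morphisms to `Y`
  have key : ∀ {Z : D}, ofHeart t T Z → ∀ ψ : Z ⟶ Y, ψ = 0 := by
    rintro Z ⟨hZ, hTZ⟩ ψ
    obtain ⟨Y₁, Y₂, f, g, d, hT, ⟨hY₁, hF⟩, hY₂⟩ := hY
    obtain ⟨χ, hχ⟩ := Triangle.coyoneda_exact₂ _ hT ψ
      (t.zero_of_isLE_of_isGE _ 0 1 (by lia) ⟨hZ.1⟩ ⟨hY₂⟩)
    have : χ = 0 := congrArg (fun a => a.hom) (h.hom_eq_zero hTZ hF (ObjectProperty.homMk χ))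
    rw [hχ, this]
    exact zero_comp
  have hY0 := tiltGE_le t F _ hY
  obtain ⟨X₁, X₂, f, g, d, hT, hX₁, hX₂⟩ := hX
  obtain ⟨χ, hχ⟩ := Triangle.yoneda_exact₂ _ hT φ
    (t.zero_of_isLE_of_isGE _ (-1) 0 (by lia) ⟨hX₁⟩ ⟨hY0⟩)
  rw [hχ, key hX₂ χ]
  exact comp_zero

/-- Each object is filtered by its negative part, the torsion and torsion-free parts of its
cohomology in degree zero, and its positive part; the first two form its truncation. -/
lemma tiltLE_extensionProduct_tiltGE (h : IsTorsionPair T F) (X : D) :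
    (tiltLE t T).extensionProduct (tiltGE t F) X := by
  have hheart : t.heart ≤ (ofHeart t T).extensionProduct (ofHeart t F) := by
    intro Y hY
    obtain ⟨A, B, f, g, w, hS, hA, hB⟩ := h.exists_shortExact ⟨Y, hY⟩
    obtain ⟨d, hd⟩ := exists_distTriang_of_shortExact hS
    exact ⟨A.obj, B.obj, f.hom, g.hom, d, hd, ⟨A.property, hA⟩, ⟨B.property, hB⟩⟩
  have hle : t.le 0 ≤ (t.le (-1)).extensionProduct t.heart := by
    intro Y hY
    obtain ⟨A, B, hA, hB, f, g, d, hd⟩ := t.exists_triangle Y (-1) 0 (by lia)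
    refine ⟨A, B, f, g, d, hd, hA, ?_, hB⟩
    exact (isLE_obj₃ t hd 0 ⟨hY⟩ ⟨t.le_monotone (by lia : (-1 : ℤ) ≤ 0 + 1) _ hA⟩).le
  obtain ⟨A, B, hA, hB, f, g, d, hd⟩ := t.exists_triangle X 0 1 (by lia)
  have hX : (((t.le (-1)).extensionProduct ((ofHeart t T).extensionProduct
      (ofHeart t F))).extensionProduct (t.ge 1)) X :=
    ⟨A, B, f, g, d, hd, ObjectProperty.monotone_extensionProduct_right _ hheart _ (hle _ hA), hB⟩
  rwa [← ObjectProperty.extensionProduct_assoc, ObjectProperty.extensionProduct_assoc] at hX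

/-- The t-structure obtained by tilting at a torsion pair in the heart. -/
def tilt (h : IsTorsionPair T F) : TStructure D where
  le n := (tiltLE t T).shift n
  ge n := (tiltGE t F).shift (n - 1)
  le_shift n a n' hn X hX := by
    rw [← ObjectProperty.shift_shift (tiltLE t T) a n' n hn] at hX
    exact hX
  ge_shift n a n' hn X hX := by
    rw [← ObjectProperty.shift_shift (tiltGE t F) a (n' - 1) (n - 1) (by lia)] at hX
    exact hX
  zero' X Y f hX hY := by
    rw [ObjectProperty.shift_zero] at hX
    rw [sub_self, ObjectProperty.shift_zero] at hY
    exact tilt_hom_eq_zero h hX hY f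
  le_zero_le X hX := by
    rw [ObjectProperty.shift_zero] at hX
    exact le_tiltLE h _ (t.le_shift 0 1 (-1) (by lia) X (tiltLE_le t T _ hX))
  ge_one_le X hX := by
    rw [sub_self, ObjectProperty.shift_zero] at hX
    exact le_tiltGE h _ (t.ge_shift 0 (0 - 1) 1 (by lia) X (tiltGE_le t F _ hX))
  exists_triangle_zero_one X := by
    obtain ⟨Y, Z, f, g, d, hd, hY, hZ⟩ := tiltLE_extensionProduct_tiltGE h X
    refine ⟨Y, Z, ?_, ?_, f, g, d, hd⟩
    · rwa [ObjectProperty.shift_zero]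
    · rwa [sub_self, ObjectProperty.shift_zero]

lemma tilt_le_zero (h : IsTorsionPair T F) : (tilt h).le 0 = tiltLE t T := by
  change (tiltLE t T).shift (0 : ℤ) = _
  rw [ObjectProperty.shift_zero]

lemma tilt_ge_one (h : IsTorsionPair T F) : (tilt h).ge 1 = tiltGE t F := by
  change (tiltGE t F).shift (1 - 1) = _
  rw [sub_self, ObjectProperty.shift_zero]

lemma isTwoTerm_tilt (ht : IsBounded t) (h : IsTorsionPair T F) : IsTwoTerm t (tilt h) := by
  have h₁ : HeartLE t (tilt h) := by
    unfold HeartLE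
    rw [tilt_ge_one]
    exact le_tiltGE h
  have h₂ : HeartLE (tilt h) (shiftOne t) := by
    unfold HeartLE
    rw [tilt_ge_one]
    exact tiltGE_le t F
  exact ⟨isBounded_of_heartLE ht h₁ h₂, h₁, h₂⟩

/-- A heart between `H` and `H[1]` induces a torsion pair in `H`. -/
lemma IsTwoTerm.isTorsionPair {k : TStructure D} (hk : IsTwoTerm t k) :
    IsTorsionPair (fun X : t.heart.FullSubcategory => k.le 0 X.obj)
      (fun X : t.heart.FullSubcategory => k.ge 1 X.obj) where
  torsion_iso X Y e hX := (k.le 0).prop_of_iso (t.heart.ι.mapIso e) hX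
  free_iso X Y e hX := (k.ge 1).prop_of_iso (t.heart.ι.mapIso e) hX
  hom_eq_zero X Y hX hY f := ObjectProperty.hom_ext _ (k.zero' f.hom hX hY)
  exists_shortExact X := by
    obtain ⟨Y, Z, hY, hZ, f, g, d, hd⟩ := k.exists_triangle_zero_one X.obj
    have hY0 : t.IsLE Y 0 := ⟨hk.ge.le_le 0 _ hY⟩
    have hZ0 : t.IsGE Z 0 := ⟨hk.ge_sub_one 1 _ hZ⟩
    have hYGE : t.IsGE Y 0 :=
      isGE_obj₁ t hd 0 (inferInstanceAs (t.IsGE X.obj 0)) (t.isGE_of_ge Z _ 0)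
    have hZLE : t.IsLE Z 0 :=
      isLE_obj₃ t hd 0 (inferInstanceAs (t.IsLE X.obj 0)) (t.isLE_of_le Y 0 _)
    let Y' : t.heart.FullSubcategory := ⟨Y, (t.mem_heart_iff _).2 ⟨hY0, hYGE⟩⟩
    let Z' : t.heart.FullSubcategory := ⟨Z, (t.mem_heart_iff _).2 ⟨hZLE, hZ0⟩⟩
    let f' : Y' ⟶ X := ObjectProperty.homMk f
    let g' : X ⟶ Z' := ObjectProperty.homMk g
    obtain ⟨w, hS⟩ := shortExact_of_distTriang f' g' hd
    exact ⟨Y', Z', f', g', w, hS, hY, hZ⟩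

lemma effectiveCone_tilt (ht : IsBounded t) (l : K₀ D →+ Λ) (h : IsTorsionPair T F) :
    effectiveCone l (tilt h).heart = torsionCone (heartClass t l) T F := by
  have hk := isTwoTerm_tilt ht h
  have h' := hk.isTorsionPair
  have hT : T ≤ fun X => (tilt h).le 0 X.obj := by
    intro X hX
    rw [tilt_le_zero]
    exact ofHeart_le_tiltLE T _ ⟨X.property, hX⟩
  have hF : F ≤ fun X => (tilt h).ge 1 X.obj := by
    intro X hX
    rw [tilt_ge_one]
    exact ofHeart_le_tiltGE F _ ⟨X.property, hX⟩
  have hT' : (fun X => (tilt h).le 0 X.obj) ≤ T := fun X hX =>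
    h.torsion_of_hom_eq_zero fun Y hY => h'.hom_eq_zero hX (hF _ hY)
  have hF' : (fun X => (tilt h).ge 1 X.obj) ≤ F := fun X hX =>
    h.free_of_hom_eq_zero fun Y hY => h'.hom_eq_zero (hT _ hY) hX
  rw [hk.effectiveCone_eq l]
  exact congrArg₂ (torsionCone (heartClass t l)) (le_antisymm hT' hT) (le_antisymm hF' hF)

/-- The effective cones of the hearts between `H` and `H[1]` are the cones of the torsion pairs
in `H`. -/
lemma effectiveCones_eq_torsionCones (ht : IsBounded t) (l : K₀ D →+ Λ) :
    {E | ∃ k : TStructure D, IsTwoTerm t k ∧ E = effectiveCone l k.heart} =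
      torsionCones (heartClass t l) := by
  ext E
  constructor
  · rintro ⟨k, hk, rfl⟩
    exact ⟨_, _, hk.isTorsionPair, hk.effectiveCone_eq l⟩
  · rintro ⟨T, F, h, rfl⟩
    exact ⟨tilt h, isTwoTerm_tilt ht h, (effectiveCone_tilt ht l h).symm⟩

lemma heartFan_eq_dualFan (ht : IsBounded t) (l : K₀ D →+ Λ) :
    heartFan l t = dualFan (torsionCones (heartClass t l)) := by
  rw [← effectiveCones_eq_torsionCones ht l]
  ext τ
  constructor
  · rintro ⟨k, hk, hτ⟩
    rw [heartCone_eq_dualCone] at hτ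
    exact ⟨_, ⟨k, hk, rfl⟩, hτ⟩
  · rintro ⟨_, ⟨k, hk, rfl⟩, hτ⟩
    refine ⟨k, hk, ?_⟩
    rwa [heartCone_eq_dualCone]

lemma realHeartCofan_eq_realCofaces (ht : IsBounded t) (l : K₀ D →+ Λ) :
    realHeartCofan l t = realCofaces (torsionCones (heartClass t l)) := by
  rw [← effectiveCones_eq_torsionCones ht l]
  unfold realHeartCofan realCofaces
  congr 1
  ext σ
  constructor
  · rintro ⟨k, hk, hσ⟩
    exact ⟨_, ⟨k, hk, rfl⟩, hσ⟩
  · rintro ⟨_, ⟨k, hk, rfl⟩, hσ⟩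
    exact ⟨k, hk, hσ⟩

end Tilting

end HeartFan

namespace HeartFan

/-! ### Closedness, strict convexity, independence and completeness -/

section HeartFan

variable {D : Type u} [Category.{v} D] [Preadditive D] [HasZeroObject D] [HasShift D ℤ]
  [∀ n : ℤ, (shiftFunctor D n).Additive] [Pretriangulated D] {t : TStructure D}

lemma map_mk_eq_zero_of_shift {G : Type*} [AddCommGroup G] (g : K₀ D →+ G) (n : ℤ) :
    ∀ X : D, g (K₀.mk (X⟦n⟧)) = 0 → g (K₀.mk X) = 0 := by
  induction n using Int.induction_on with
  | zero =>
    intro X hX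
    rwa [K₀.mk_of_iso ((shiftFunctorZero D ℤ).app X)] at hX
  | succ n ih =>
    intro X hX
    rw [K₀.mk_of_iso ((shiftFunctorAdd' D (n : ℤ) 1 (n + 1) rfl).app X)] at hX
    refine ih X (neg_eq_zero.1 ?_)
    rw [← map_neg, ← K₀.mk_shift_one]
    exact hX
  | pred n ih =>
    intro X hX
    rw [K₀.mk_of_iso ((shiftFunctorAdd' D (-(n : ℤ)) (-1) (-n - 1) rfl).app X)] at hX
    refine ih X (neg_eq_zero.1 ?_)
    rw [← map_neg, ← K₀.mk_shift_neg_one]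
    exact hX

/-- The classes of the objects of a bounded heart generate the Grothendieck group. -/
lemma eq_zero_of_heart {G : Type*} [AddCommGroup G] (ht : IsBounded t) (g : K₀ D →+ G)
    (hg : ∀ X, t.heart X → g (K₀.mk X) = 0) : g = 0 := by
  -- induction on the number of degrees, splitting off the lowest cohomology object
  have key : ∀ (d : ℕ) (m : ℤ) (X : D), t.IsGE X m → t.IsLE X (m + d - 1) →
      g (K₀.mk X) = 0 := by
    intro d
    induction d with
    | zero =>
      intro m X hX hX'
      rw [K₀.mk_of_isZero (t.isZero X (m + (0 : ℕ) - 1) m (by lia)), map_zero]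
    | succ d ih =>
      intro m X hX hX'
      obtain ⟨Y, Z, hY, hZ, f, h, δ, hT⟩ := t.exists_triangle X m (m + 1) rfl
      have hY' : t.IsLE Y m := ⟨hY⟩
      have hZ' : t.IsGE Z (m + 1) := ⟨hZ⟩
      have hYGE : t.IsGE Y m := isGE_obj₁ t hT m hX (t.isGE_of_ge Z _ (m + 1))
      have hZLE : t.IsLE Z (m + 1 + d - 1) := isLE_obj₃ t hT _
        (t.isLE_of_le X (m + (d + 1 : ℕ) - 1) _) (t.isLE_of_le Y m _)
      have hY0 : g (K₀.mk Y) = 0 := map_mk_eq_zero_of_shift g m Y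
        (hg _ ((t.mem_heart_iff _).2 ⟨t.isLE_shift Y m m 0, t.isGE_shift Y m m 0⟩))
      have hcl : K₀.mk X = K₀.mk Y + K₀.mk Z := K₀.mk_obj₂ hT
      rw [hcl, map_add, hY0, ih (m + 1) Z hZ' hZLE, add_zero]
  refine ext_hom_of_K₀ fun X => ?_
  have hX : t.bounded X := by rw [show t.bounded = ⊤ from ht]; trivial
  obtain ⟨⟨n, hn⟩, ⟨m, hm⟩⟩ := hX
  exact key (m - n + 1).toNat n X hn (t.isLE_of_le X m _)

variable {Λ : Type w} [AddCommGroup Λ]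

lemma isClosed_heartCone (l : K₀ D →+ Λ) (P : ObjectProperty D) :
    IsClosed[dualTopology Λ] (heartCone l P : Set (Λ →+ ℝ)) := by
  refine isClosed_induced_iff.2 ⟨{φ : Λ → ℝ | ∀ X, P X → 0 ≤ φ (l (K₀.mk X))}, ?_, rfl⟩
  simp only [Set.ofPred_forall]
  exact isClosed_iInter fun X => isClosed_iInter fun _ =>
    isClosed_le continuous_const (continuous_apply _)

lemma heartCone_salient (ht : IsBounded t) {l : K₀ D →+ Λ} (hl : Function.Surjective l)
    {f : Λ →+ ℝ} (hf : f ∈ heartCone l t.heart) (hf' : -f ∈ heartCone l t.heart) : f = 0 := by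
  have h0 : f.comp l = 0 := eq_zero_of_heart ht _ fun X hX =>
    le_antisymm (neg_nonneg.1 (hf' X hX)) (hf X hX)
  ext x
  obtain ⟨y, rfl⟩ := hl x
  exact DFunLike.congr_fun h0 y

variable [IsTriangulated D]

lemma isComplete_heartFan (ht : IsBounded t) (l : K₀ D →+ Λ)
    (hH : IsLength t.heart.FullSubcategory) : IsComplete (heartFan l t) := by
  rw [heartFan_eq_dualFan ht]
  refine Set.eq_univ_of_forall fun f => ?_
  have hφ : IsAdditiveFunction fun X => f (heartClass t l X) := fun S hS =>
    (congrArg f (isAdditiveFunction_heartClass t l hS)).trans (map_add f _ _)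
  obtain ⟨T, F, h, hT, hF⟩ := exists_torsionPair_of_isLength hH hφ
  refine Set.mem_biUnion (x := dualCone (torsionCone (heartClass t l) T F))
    ⟨_, ⟨T, F, h, rfl⟩, .rfl⟩ ?_
  refine mem_dualCone_closure.2 ?_
  rintro _ (⟨X, hX, rfl⟩ | ⟨X, hX, rfl⟩)
  · exact hT X hX
  · rw [map_neg]
    exact neg_nonneg.2 (hF X hX)

lemma heartFan_eq_of_equivalence (ht : IsBounded t) (l : K₀ D →+ Λ)
    {D' : Type u'} [Category.{v'} D'] [Preadditive D'] [HasZeroObject D'] [HasShift D' ℤ]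
    [∀ n : ℤ, (shiftFunctor D' n).Additive] [Pretriangulated D'] [IsTriangulated D']
    (l' : K₀ D' →+ Λ) {t' : TStructure D'} (ht' : IsBounded t')
    (e : t.heart.FullSubcategory ≌ t'.heart.FullSubcategory)
    (he : ∀ X, heartClass t' l' (e.functor.obj X) = heartClass t l X) :
    heartFan l' t' = heartFan l t := by
  rw [heartFan_eq_dualFan ht, heartFan_eq_dualFan ht']
  have hc := isAdditiveFunction_heartClass t l
  have hc' := isAdditiveFunction_heartClass t' l'
  congr 1
  refine subset_antisymm (torsionCones_subset_of_equivalence hc' e he)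
    (torsionCones_subset_of_equivalence hc e.symm fun X => ?_)
  exact (he _).symm.trans (hc'.eq_of_iso (e.counitIso.app X))

end HeartFan

end HeartFan

theorem mainTheorem1
    {D : Type u} [Category.{v} D] [Preadditive D] [HasZeroObject D] [HasShift D ℤ]
    [∀ n : ℤ, (shiftFunctor D n).Additive] [Pretriangulated D] [IsTriangulated D]
    {Λ : Type w} [AddCommGroup Λ] [Module.Free ℤ Λ] [Module.Finite ℤ Λ]
    (l : HeartFan.K₀ D →+ Λ) (t : TStructure D) (ht : HeartFan.IsBounded t) :
    -- the heart cone is closed, and strictly convex if `l` is surjective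
    IsClosed[HeartFan.dualTopology Λ] (HeartFan.heartCone l t.heart : Set (Λ →+ ℝ)) ∧
    (Function.Surjective l →
      ∀ f : Λ →+ ℝ, f ∈ HeartFan.heartCone l t.heart → -f ∈ HeartFan.heartCone l t.heart →
        f = 0) ∧
    -- the heart fan is a fan, namely the one associated to the real heart cofan
    HeartFan.IsFan (HeartFan.heartFan l t) ∧
    HeartFan.IsCofan (HeartFan.realHeartCofan l t) ∧
    HeartFan.heartFan l t = HeartFan.associatedFan (HeartFan.realHeartCofan l t) ∧
    -- the heart fan does not depend on the ambient triangulated category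
    (∀ (D' : Type u') [Category.{v'} D'] [Preadditive D'] [HasZeroObject D'] [HasShift D' ℤ]
      [∀ n : ℤ, (shiftFunctor D' n).Additive] [Pretriangulated D'] [IsTriangulated D']
      (l' : HeartFan.K₀ D' →+ Λ) (t' : TStructure D') (_ : HeartFan.IsBounded t')
      (e : t.heart.FullSubcategory ≌ t'.heart.FullSubcategory),
      (∀ X : t.heart.FullSubcategory,
        l' (HeartFan.K₀.mk (e.functor.obj X).obj) = l (HeartFan.K₀.mk X.obj)) →
      HeartFan.heartFan l' t' = HeartFan.heartFan l t) ∧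
    -- the heart fan of a length heart is complete
    (HeartFan.IsLength t.heart.FullSubcategory →
      HeartFan.IsComplete (HeartFan.heartFan l t)) := by
  have hsplit := HeartFan.hasSplitting_torsionCones (HeartFan.isAdditiveFunction_heartClass t l)
  refine ⟨HeartFan.isClosed_heartCone l t.heart,
    fun hl f hf hf' => HeartFan.heartCone_salient ht hl hf hf', ?_, ?_, ?_,
    fun D' _ _ _ _ _ _ _ l' t' ht' e he => HeartFan.heartFan_eq_of_equivalence ht l l' ht' e he,
    HeartFan.isComplete_heartFan ht l⟩
  · rw [HeartFan.heartFan_eq_dualFan ht]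
    exact hsplit.isFan
  · rw [HeartFan.realHeartCofan_eq_realCofaces ht]
    exact hsplit.isCofan
  · rw [HeartFan.heartFan_eq_dualFan ht, HeartFan.realHeartCofan_eq_realCofaces ht,
      HeartFan.associatedFan_realCofaces]
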